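/- Let $\mathbb{F}_q$ be a finite field, let $\mathfrak{E}$ be an elliptic curve over $\mathbb{F}_q$ given by a nonsingular Weierstrass equation $y^2+a_1xy+a_3y=x^3+a_2x^2+a_4x+a_6$ with $a_i\in\mathbb{F}_q$, and let $E=\mathbb{F}_q(x,y)$ be its function field. Let $O$ be the unique common pole of $x$ and $y$, and let $\mathbb{P}^1_E$ be the set of rational places of $E$ (places of degree one). For $P,Q\in\mathbb{P}^1_E$ let $P\oplus Q$ be the unique $R\in\mathbb{P}^1_E$ such that the divisors $P+Q$ and $R+O$ are linearly equivalent; on the function field $E\bar{\mathbb{F}}_q$ of $\mathfrak{E}$ over the algebraic closure $\bar{\mathbb{F}}_q$, the operation $\oplus$ on places is defined in the same way. Let $\mathrm{Aut}(E/\mathbb{F}_q)$ be the group of $\mathbb{F}_q$-automorphisms of $E$, acting on places by $\sigma(P)=\{\sigma(z): z\in P\}$, and let $\mathrm{Aut}(E,O)=\{\sigma\in\mathrm{Aut}(E/\mathbb{F}_q):\sigma(O)=O\}$. For $Q\in\mathbb{P}^1_E$ let $\tau_Q$ be the translation by $Q$, that is, the unique automorphism of $E/\mathbb{F}_q$ whose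 $\bar{\mathbb{F}}_q$-linear extension to $E\bar{\mathbb{F}}_q$ maps every place $P$ of $E\bar{\mathbb{F}}_q$ to $P\oplus Q$ (where $Q$ is identified with the unique place of $E\bar{\mathbb{F}}_q$ lying over it). Put $T_E=\{\tau_Q: Q\in\mathbb{P}^1_E\}$. Then $O$, $\oplus$ and the translations $\tau_Q$ are well defined, $T_E$ is a normal subgroup of $\mathrm{Aut}(E/\mathbb{F}_q)$, and $\mathrm{Aut}(E/\mathbb{F}_q)$ is the (internal) semidirect product $$\mathrm{Aut}(E/\mathbb{F}_q)=T_E\rtimes\mathrm{Aut}(E,O),$$ that is, every element of $\mathrm{Aut}(E/\mathbb{F}_q)$ is in exactly one way a product $\tau\alpha$ with $\tau\in T_E$ and $\alpha\in\mathrm{Aut}(E,O)$. The group law is as follows: for all $P,Q\in\mathbb{P}^1_E$ and $\alpha,\beta\in\mathrm{Aut}(E,O)$, the place $\alpha(Q)$ is rational and $$(\tau_P\alpha)(\tau_Q\beta)=\tau_{P\oplus\alpha(Q)}\,\alpha\beta .$$ -/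

import Mathlib

open scoped Pointwise

noncomputable section

namespace EllipticFunctionField

/-! ### Places and divisors of a field extension `K / k` -/

/-- A place of `K / k`, given by its valuation ring: a valuation ring of `K` which contains `k` and
is different from `K`. -/
@[ext]
structure Place (k K : Type*) [Field k] [Field K] [Algebra k K] where
  /-- The valuation ring of the place. -/
  ring : ValuationSubring K
  algebraMap_mem : ∀ c : k, algebraMap k K c ∈ ring
  ne_top : ring ≠ ⊤

namespace Place

variable {k K : Type*} [Field k] [Field K] [Algebra k K]

/-- The structure map from the constants to the residue class field of a place. -/
def constantsToResidueField (P : Place k K) : k →+* IsLocalRing.ResidueField P.ring :=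
  (IsLocalRing.residue P.ring).comp ((algebraMap k K).codRestrict P.ring P.algebraMap_mem)

/-- The degree of a place: the degree of its residue class field over the field of constants. -/
def degree (P : Place k K) : ℕ :=
  letI : Algebra k (IsLocalRing.ResidueField P.ring) := P.constantsToResidueField.toAlgebra
  Module.finrank k (IsLocalRing.ResidueField P.ring)

/-- `P.HasOrder z n`: one has `z = t ^ n * u` with a prime element `t` of the valuation ring of `P`
and a unit `u` of it. -/
def HasOrder (P : Place k K) (z : K) (n : ℤ) : Prop :=
  ∃ (t : P.ring) (u : P.ringˣ), Irreducible t ∧ z = (t : K) ^ n * ((u : P.ring) : K)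

open Classical in
/-- The normalized discrete valuation `ν_P` of a place, on nonzero functions.
(The value at `0` is a placeholder and is never used.) -/
def ord (P : Place k K) (z : K) : ℤ :=
  if h : ∃ n : ℤ, P.HasOrder z n then h.choose else 0

/-- Automorphisms of `K / k` act on places by `σ(P) = {σ(z) : z ∈ P}`. -/
instance : SMul (K ≃ₐ[k] K) (Place k K) where
  smul σ P :=
    { ring := σ • P.ring
      algebraMap_mem := fun c => by
        rw [ValuationSubring.mem_smul_pointwise_iff_exists]
        exact ⟨algebraMap k K c, P.algebraMap_mem c, σ.commutes c⟩
      ne_top := fun h => P.ne_top <| by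
        refine top_le_iff.mp fun z _ => ?_
        have hz : σ • z ∈ σ • P.ring := by rw [h]; trivial
        rwa [ValuationSubring.smul_mem_pointwise_smul_iff] at hz }

instance : MulAction (K ≃ₐ[k] K) (Place k K) where
  one_smul P := Place.ext (one_smul _ P.ring)
  mul_smul σ τ P := Place.ext (mul_smul σ τ P.ring)

end Place

/-- The divisor group of `K / k`: the free abelian group on the places. -/
abbrev Divisor (k K : Type*) [Field k] [Field K] [Algebra k K] : Type _ := Place k K →₀ ℤ

/-- Equivalence of divisors: `A ~ B` if `A = B + (z)` for some `z ≠ 0`, where `(z)` is the principal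
divisor with coefficient `ν_P(z)` at `P`. -/
def Divisor.Equivalent {k K : Type*} [Field k] [Field K] [Algebra k K] (A B : Divisor k K) : Prop :=
  ∃ z : K, z ≠ 0 ∧ ∀ P : Place k K, A P = B P + P.ord z

/-- The prime divisor of a place. -/
def Place.divisor {k K : Type*} [Field k] [Field K] [Algebra k K] (P : Place k K) : Divisor k K :=
  Finsupp.single P 1

/-! ### The function field of a Weierstrass curve -/

variable {F : Type*} [Field F]

/-- The function field `F(x, y)` of a Weierstrass curve over `F`. -/
abbrev FunField (W : WeierstrassCurve F) : Type _ := W.toAffine.FunctionField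

/-- The coordinate function `x`. -/
def coordX (W : WeierstrassCurve F) : FunField W :=
  algebraMap W.toAffine.CoordinateRing _
    (WeierstrassCurve.Affine.CoordinateRing.mk W.toAffine (Polynomial.C Polynomial.X))

/-- The coordinate function `y`. -/
def coordY (W : WeierstrassCurve F) : FunField W :=
  algebraMap W.toAffine.CoordinateRing _
    (WeierstrassCurve.Affine.CoordinateRing.mk W.toAffine Polynomial.X)

theorem coordX_not_isIntegral (W : WeierstrassCurve F) : ¬ IsIntegral F (coordX W) := by
  intro h
  obtain ⟨p, hp0, hp⟩ := h.isAlgebraic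
  have hinj : Function.Injective (algebraMap (Polynomial F) W.toAffine.CoordinateRing) :=
    FaithfulSMul.algebraMap_injective _ _
  have hx : coordX W = algebraMap W.toAffine.CoordinateRing (FunField W)
      (algebraMap (Polynomial F) W.toAffine.CoordinateRing Polynomial.X) := rfl
  rw [hx, Polynomial.aeval_algebraMap_apply] at hp
  have h1 := (IsFractionRing.injective W.toAffine.CoordinateRing (FunField W))
    (hp.trans (map_zero _).symm)
  rw [Polynomial.aeval_algebraMap_apply] at h1
  have h2 := hinj (h1.trans (map_zero _).symm)
  rw [Polynomial.aeval_X_left_apply] at h2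
  exact hp0 h2

theorem map_polynomial {K : Type*} [CommRing K] (W : WeierstrassCurve F)
    (φ : Polynomial (Polynomial F) →+* K) :
    φ W.toAffine.polynomial = φ Polynomial.X ^ 2
      + (φ (Polynomial.C (Polynomial.C W.a₁)) * φ (Polynomial.C Polynomial.X)
        + φ (Polynomial.C (Polynomial.C W.a₃))) * φ Polynomial.X
      - (φ (Polynomial.C Polynomial.X) ^ 3
        + φ (Polynomial.C (Polynomial.C W.a₂)) * φ (Polynomial.C Polynomial.X) ^ 2
        + φ (Polynomial.C (Polynomial.C W.a₄)) * φ (Polynomial.C Polynomial.X)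
        + φ (Polynomial.C (Polynomial.C W.a₆))) := by
  unfold WeierstrassCurve.Affine.polynomial
  simp only [map_sub, map_add, map_mul, map_pow]

theorem coord_equation (W : WeierstrassCurve F) :
    coordY W ^ 2 + algebraMap F _ W.a₁ * coordX W * coordY W + algebraMap F _ W.a₃ * coordY W =
      coordX W ^ 3 + algebraMap F _ W.a₂ * coordX W ^ 2 + algebraMap F _ W.a₄ * coordX W
        + algebraMap F _ W.a₆ := by
  let φ : Polynomial (Polynomial F) →+* FunField W :=
    (algebraMap W.toAffine.CoordinateRing (FunField W)).comp
      (WeierstrassCurve.Affine.CoordinateRing.mk W.toAffine)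
  have h : φ W.toAffine.polynomial = 0 :=
    (congrArg (algebraMap W.toAffine.CoordinateRing (FunField W)) AdjoinRoot.mk_self).trans
      (map_zero _)
  have hc (c : F) : φ (Polynomial.C (Polynomial.C c)) = algebraMap F (FunField W) c := rfl
  have hx : φ (Polynomial.C Polynomial.X) = coordX W := rfl
  have hy : φ Polynomial.X = coordY W := rfl
  rw [map_polynomial, hx, hy] at h
  simp only [hc] at h
  linear_combination h

/-- There is a place of `F(x, y)` at which both `x` and `y` have a pole. -/
theorem exists_commonPole (W : WeierstrassCurve F) :
    ∃ P : Place F (FunField W), coordX W ∉ P.ring ∧ coordY W ∉ P.ring := by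
  have hs : coordX W ∉ (integralClosure (Subring.closure
      (Set.range (algebraMap F (FunField W)))) (FunField W)).toSubring := by
    intro h
    have h' : IsIntegral (Subring.closure (Set.range (algebraMap F (FunField W)))) (coordX W) := h
    have hcl : Subring.closure (Set.range (algebraMap F (FunField W))) =
        (algebraMap F (FunField W)).range := by
      rw [← RingHom.coe_range, Subring.closure_eq]
    rw [hcl] at h'
    obtain ⟨p, hp, hp0⟩ := h'
    refine coordX_not_isIntegral W ?_
    obtain ⟨q, hq, -, hqm⟩ := Polynomial.lifts_and_natDegree_eq_and_monic
      (f := (algebraMap F (FunField W)).rangeRestrict) (p := p)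
      (by
        rw [Polynomial.mem_lifts]
        exact Polynomial.map_surjective _ (RingHom.rangeRestrict_surjective _) p) hp
    refine ⟨q, hqm, ?_⟩
    rw [← hq, Polynomial.eval₂_map] at hp0
    exact hp0
  rw [← iInf_valuationSubring_superset, Subring.mem_iInf] at hs
  push Not at hs
  obtain ⟨⟨V, hV⟩, hxV⟩ := hs
  have hF (c : F) : algebraMap F (FunField W) c ∈ V := hV ⟨c, rfl⟩
  have hx : coordX W ∉ V := hxV
  refine ⟨⟨V, hF, fun h => hx (h ▸ trivial)⟩, hx, fun hy => hx ?_⟩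
  have hy' : coordY W ∈ V := hy
  -- The Weierstrass equation makes `x` integral over `F[y]`.
  have hint : IsIntegral V (coordX W) := by
    set y : V := ⟨coordY W, hy'⟩ with hyd
    set a : F → V := fun c => ⟨algebraMap F _ c, hF c⟩ with ha
    refine ⟨Polynomial.X ^ 3 + Polynomial.C (a W.a₂) * Polynomial.X ^ 2
      + Polynomial.C (a W.a₄ - a W.a₁ * y) * Polynomial.X
      + Polynomial.C (a W.a₆ - y ^ 2 - a W.a₃ * y), by monicity!, ?_⟩
    have h := coord_equation W
    simp only [Polynomial.eval₂_add, Polynomial.eval₂_mul, Polynomial.eval₂_pow,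
      Polynomial.eval₂_X, Polynomial.eval₂_C]
    simp only [map_sub, map_mul, map_pow]
    have e1 (c : F) : algebraMap V (FunField W) (a c) = algebraMap F _ c := rfl
    have e2 : algebraMap V (FunField W) y = coordY W := rfl
    rw [e1, e1, e1, e1, e1, e2]
    linear_combination -h
  obtain ⟨v, hv⟩ := (IsIntegrallyClosed.isIntegral_iff (R := V)).mp hint
  rw [← hv]
  exact v.2

/-- The infinite place `O`: the common pole of `x` and `y`. -/
def infinitePlace (W : WeierstrassCurve F) : Place F (FunField W) :=
  (exists_commonPole W).choose

/-- `P ⊕ Q = R` for places of degree one, that is, `P + Q ~ R + O`. -/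
def IsSum (W : WeierstrassCurve F) (P Q R : Place F (FunField W)) : Prop :=
  Divisor.Equivalent (P.divisor + Q.divisor) (R.divisor + (infinitePlace W).divisor)

open Classical in
/-- The sum `P ⊕ Q` of two rational places: the rational place `R` with `P + Q ~ R + O`. -/
def placeAdd (W : WeierstrassCurve F) (P Q : Place F (FunField W)) : Place F (FunField W) :=
  if h : ∃ R : Place F (FunField W), R.degree = 1 ∧ IsSum W P Q R then h.choose
  else infinitePlace W

/-- The stabilizer `Aut(E, O)` of the infinite place in `Aut(E / F)`. -/
def stabilizerO (W : WeierstrassCurve F) : Subgroup (FunField W ≃ₐ[F] FunField W) :=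
  MulAction.stabilizer (FunField W ≃ₐ[F] FunField W) (infinitePlace W)

/-! ### Translations -/

/-- The curve `W` over the algebraic closure of `F`. -/
abbrev geomCurve (W : WeierstrassCurve F) : WeierstrassCurve (AlgebraicClosure F) :=
  W.map (algebraMap F (AlgebraicClosure F))

/-- The inclusion of `F(x, y)` into the constant field extension with constants the algebraic
closure of `F`. -/
def toGeom (W : WeierstrassCurve F) : FunField W →+* FunField (geomCurve W) :=
  IsFractionRing.map (WeierstrassCurve.Affine.CoordinateRing.map_injective (W' := W.toAffine)
    (algebraMap F (AlgebraicClosure F)).injective)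

/-- `σ` is the translation `P ↦ P ⊕ Q` by the rational place `Q`. An automorphism of `E / F` is not
determined by what it does to the finitely many rational places of `E`; as usual, the formula
`σ(P) = P ⊕ Q` is required for all places `P` over the algebraic closure. Here `σ'` is the extension
of `σ` to the constant field extension and `Q'` is the place lying over `Q`. -/
def IsTranslation (W : WeierstrassCurve F) (Q : Place F (FunField W))
    (σ : FunField W ≃ₐ[F] FunField W) : Prop :=
  ∃ σ' : FunField (geomCurve W) ≃ₐ[AlgebraicClosure F] FunField (geomCurve W),
    (∀ z, σ' (toGeom W z) = toGeom W (σ z)) ∧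
    ∃ Q' : Place (AlgebraicClosure F) (FunField (geomCurve W)),
      (∀ z, toGeom W z ∈ Q'.ring ↔ z ∈ Q.ring) ∧
      ∀ P : Place (AlgebraicClosure F) (FunField (geomCurve W)),
        IsSum (geomCurve W) P Q' (σ' • P)

open Classical in
/-- The translation `τ_Q` by a rational place `Q`. -/
def translation (W : WeierstrassCurve F) (Q : Place F (FunField W)) :
    FunField W ≃ₐ[F] FunField W :=
  if h : ∃ σ, IsTranslation W Q σ then h.choose else 1

end EllipticFunctionField
end

open EllipticFunctionField

/-! For an elliptic curve, sending a rational point to the place centred at it is a bijection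
`placeOf` onto the places of degree one, with the point at infinity going to `O`
(`exists_eq_placeOf`, `placeOf_injective`). Under this bijection ⊕ is the chord-and-tangent law. The
quotient of a chord by a vertical line shows that P + Q is equivalent to the sum point plus O
(`equivalent_placeOf_add`). Uniqueness holds because no function has a simple pole at O as its only
pole (`Place.ord_infinitePlace_ne_neg_one`): over the algebraic closure such a function is p(x) +
q(x)y, whose pole order is the larger of 2 deg p and 2 deg q + 3, never 1. Together these give
`equivalent_placeOf_iff`.

Translations come from the generic point η = (x, y), a point of the curve over its own function
field. The coordinates of η + Q satisfy the Weierstrass equation and the first is transcendental, so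
some endomorphism of the field carries η to η + Q (`pullbackHom`). These endomorphisms compose
according to the group law, hence are invertible, and τ_Q is the inverse of the one for Q
(`translationEquiv`). Its effect on places is computed over the algebraic closure, where every place
comes from a point: the addition formulas settle all points but three, and since automorphisms act
on points by affine maps the exceptions follow (`translationEquiv_smul_placeOf`). A translation is
determined by its action there, because an automorphism fixing all geometric places is trivial
(`eq_one_of_forall_smul_eq`).

The group structure is then formal. Since τ_Q(O) = Q, every σ is τ_{σ(O)} times an element fixing O,
and only the trivial translation fixes O. An automorphism α fixing O preserves the relation P + Q ~
R + O, so α τ_Q α⁻¹ is a translation by α(Q) and equals τ_{α(Q)} by uniqueness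
(`conj_translationEquiv`). Normality and the group law follow. -/

noncomputable section
namespace EllipticFunctionField

/-! ### Valuations, uniformizers, residues and the action of automorphisms. -/

namespace Place

variable {k K : Type*} [Field k] [Field K] [Algebra k K]

/-- The valuation attached to a place. -/
abbrev val (P : Place k K) : Valuation K P.ring.ValueGroup := P.ring.valuation

theorem val_le_one_iff (P : Place k K) (f : K) : P.val f ≤ 1 ↔ f ∈ P.ring :=
  P.ring.valuation_le_one_iff f

theorem one_lt_val_iff (P : Place k K) (f : K) : 1 < P.val f ↔ f ∉ P.ring := by
  rw [← val_le_one_iff, not_le]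

theorem val_lt_one_iff (P : Place k K) (f : K) : P.val f < 1 ↔ f = 0 ∨ f⁻¹ ∉ P.ring := by
  rcases eq_or_ne f 0 with rfl | hf
  · simp
  · rw [← one_lt_val_iff, map_inv₀, one_lt_inv₀ (zero_lt_iff.mpr ((Valuation.ne_zero_iff _).mpr hf))]
    simp [hf]

theorem val_algebraMap_le (P : Place k K) (c : k) : P.val (algebraMap k K c) ≤ 1 :=
  (P.val_le_one_iff _).mpr (P.algebraMap_mem c)

theorem val_algebraMap (P : Place k K) {c : k} (hc : c ≠ 0) : P.val (algebraMap k K c) = 1 := by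
  refine le_antisymm (P.val_algebraMap_le c) ?_
  have h := P.val_algebraMap_le c⁻¹
  rw [map_inv₀, map_inv₀] at h
  exact (inv_le_one₀ (zero_lt_iff.mpr ((Valuation.ne_zero_iff _).mpr (by simpa using hc)))).mp h

theorem exists_one_lt_val (P : Place k K) : ∃ f : K, 1 < P.val f := by
  by_contra! h
  exact P.ne_top (top_le_iff.mp fun f _ => (P.val_le_one_iff f).mp (h f))

theorem val_pos (P : Place k K) {f : K} (hf : f ≠ 0) : 0 < P.val f :=
  zero_lt_iff.mpr ((Valuation.ne_zero_iff _).mpr hf)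

/-- `t` is a uniformizer of `P`: it has positive valuation, and every nonzero function has the
valuation of a power of `t`. -/
structure IsUniformizer (P : Place k K) (t : K) : Prop where
  ne_zero : t ≠ 0
  val_lt_one : P.val t < 1
  exists_zpow : ∀ f : K, f ≠ 0 → ∃ n : ℤ, P.val f = P.val t ^ n

theorem IsUniformizer.zpow_injective {P : Place k K} {t : K} (ht : P.IsUniformizer t) {m n : ℤ}
    (h : P.val t ^ m = P.val t ^ n) : m = n :=
  (zpow_right_injective₀ (P.val_pos ht.ne_zero) ht.val_lt_one.ne) h

theorem IsUniformizer.zpow_lt_zpow_iff {P : Place k K} {t : K} (ht : P.IsUniformizer t) {m n : ℤ} :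
    P.val t ^ m < P.val t ^ n ↔ n < m :=
  zpow_lt_zpow_iff_right_of_lt_one₀ (P.val_pos ht.ne_zero) ht.val_lt_one

theorem isUnit_iff_val (P : Place k K) (a : P.ring) : IsUnit a ↔ P.val (a : K) = 1 :=
  P.ring.valuation_eq_one_iff a

theorem not_isUnit_iff_val (P : Place k K) (a : P.ring) : ¬ IsUnit a ↔ P.val (a : K) < 1 := by
  rw [isUnit_iff_val]
  exact ⟨fun h => lt_of_le_of_ne ((P.val_le_one_iff _).mpr a.2) h, fun h => h.ne⟩

theorem IsUniformizer.irreducible {P : Place k K} {t : K} (ht : P.IsUniformizer t)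
    (htm : t ∈ P.ring) : Irreducible (⟨t, htm⟩ : P.ring) := by
  refine ⟨(P.not_isUnit_iff_val _).mpr ht.val_lt_one, fun a b hab => ?_⟩
  by_contra! h
  rw [not_isUnit_iff_val, not_isUnit_iff_val] at h
  have hK : t = (a : K) * b := congrArg Subtype.val hab
  have hab0 : (a : K) * b ≠ 0 := hK ▸ ht.ne_zero
  obtain ⟨m, hm⟩ := ht.exists_zpow a (left_ne_zero_of_mul hab0)
  obtain ⟨n, hn⟩ := ht.exists_zpow b (right_ne_zero_of_mul hab0)
  have h1 : P.val t ^ (1 : ℤ) = P.val t ^ (m + n) := by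
    rw [zpow_add₀ (P.val_pos ht.ne_zero).ne', ← hm, ← hn, zpow_one, ← map_mul, ← hK]
  have := ht.zpow_injective h1
  have hm' : P.val t ^ m < P.val t ^ (0 : ℤ) := by rw [← hm, zpow_zero]; exact h.1
  have hn' : P.val t ^ n < P.val t ^ (0 : ℤ) := by rw [← hn, zpow_zero]; exact h.2
  rw [ht.zpow_lt_zpow_iff] at hm' hn'
  omega

/-- `HasOrder` allows any prime element `s` of the ring. Such an `s` has positive exponent, so it is
a multiple of `t`, and irreducibility makes the cofactor a unit: all prime elements have the
valuation of `t`. Hence orders can be computed with one fixed uniformizer. -/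
theorem IsUniformizer.hasOrder_iff {P : Place k K} {t : K} (ht : P.IsUniformizer t) {f : K}
    (n : ℤ) (hf : f ≠ 0) : P.HasOrder f n ↔ P.val f = P.val t ^ n := by
  have htm : t ∈ P.ring := (P.val_le_one_iff t).mp ht.val_lt_one.le
  constructor
  · rintro ⟨s, u, hs, rfl⟩
    have hs0 : (s : K) ≠ 0 := fun h => hs.ne_zero (Subtype.ext h)
    have hu : P.val ((u : P.ring) : K) = 1 := (P.isUnit_iff_val _).mp u.isUnit
    rw [map_mul, hu, mul_one, map_zpow₀]
    congr 1
    obtain ⟨m, hm⟩ := ht.exists_zpow s hs0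
    have hs1 : P.val (s : K) < 1 := (P.not_isUnit_iff_val _).mp hs.not_isUnit
    have hm1 : 0 < m := by
      rw [← ht.zpow_lt_zpow_iff, zpow_zero, ← hm]; exact hs1
    have hq : (s : K) / t ∈ P.ring := by
      rw [← val_le_one_iff, map_div₀, hm, div_le_one₀ (P.val_pos ht.ne_zero)]
      nth_rewrite 2 [← zpow_one (P.val t)]
      rcases eq_or_ne m 1 with rfl | h1
      · exact le_rfl
      · exact (ht.zpow_lt_zpow_iff.mpr (by omega)).le
    have hfac : s = (⟨t, htm⟩ : P.ring) * ⟨s / t, hq⟩ := Subtype.ext (by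
      change (s : K) = t * (s / t)
      field_simp [ht.ne_zero])
    rcases hs.isUnit_or_isUnit hfac with h | h
    · exact absurd h (ht.irreducible htm).not_isUnit
    · have := (P.isUnit_iff_val _).mp h
      change P.val ((s : K) / t) = 1 at this
      rw [map_div₀, div_eq_one_iff_eq (P.val_pos ht.ne_zero).ne'] at this
      exact this
  · intro h
    have hu : P.val (f / t ^ n) = 1 := by
      rw [map_div₀, map_zpow₀, h, div_self]
      exact zpow_ne_zero _ (P.val_pos ht.ne_zero).ne'
    have hum : f / t ^ n ∈ P.ring := (P.val_le_one_iff _).mp hu.le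
    have hunit : IsUnit (⟨f / t ^ n, hum⟩ : P.ring) := (P.isUnit_iff_val _).mpr hu
    refine ⟨⟨t, htm⟩, hunit.unit, ht.irreducible htm, ?_⟩
    change f = t ^ n * (f / t ^ n)
    field_simp [zpow_ne_zero n ht.ne_zero]

theorem IsUniformizer.val_eq_zpow_ord {P : Place k K} {t : K} (ht : P.IsUniformizer t) {f : K}
    (hf : f ≠ 0) : P.val f = P.val t ^ P.ord f := by
  obtain ⟨n, hn⟩ := ht.exists_zpow f hf
  have h : ∃ n, P.HasOrder f n := ⟨n, (ht.hasOrder_iff n hf).mpr hn⟩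
  rw [ord, dif_pos h]
  exact (ht.hasOrder_iff _ hf).mp h.choose_spec

theorem IsUniformizer.ord_eq {P : Place k K} {t : K} (ht : P.IsUniformizer t) {f : K}
    {n : ℤ} (hf : f ≠ 0) (h : P.val f = P.val t ^ n) : P.ord f = n :=
  ht.zpow_injective ((ht.val_eq_zpow_ord hf).symm.trans h)

theorem ord_eq_zero_of_val_eq_one (P : Place k K) {f : K} (h : P.val f = 1) : P.ord f = 0 := by
  rw [ord]
  split_ifs with hex
  · obtain ⟨t, u, ht, hf⟩ := hex.choose_spec
    have hu : P.val ((u : P.ring) : K) = 1 := (P.isUnit_iff_val _).mp u.isUnit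
    have ht1 : P.val (t : K) < 1 := (P.not_isUnit_iff_val _).mp ht.not_isUnit
    have ht0 : (t : K) ≠ 0 := fun h => ht.ne_zero (Subtype.ext h)
    rw [hf, map_mul, hu, mul_one, map_zpow₀, ← zpow_zero (P.val (t : K))] at h
    exact zpow_right_injective₀ (P.val_pos ht0) ht1.ne h
  -- When no order exists, `ord` takes its default value 0, which agrees with the claim; so
  -- discreteness of the valuation is not needed.
  · rfl

/-- `f` has residue `c` at `P`. -/
def HasResidue (P : Place k K) (f : K) (c : k) : Prop := P.val (f - algebraMap k K c) < 1

section HasResidue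
variable {P : Place k K} {f g : K} {c d : k}

theorem hasResidue_algebraMap (P : Place k K) (c : k) : P.HasResidue (algebraMap k K c) c := by
  simp [HasResidue]

theorem HasResidue.add (hf : P.HasResidue f c) (hg : P.HasResidue g d) :
    P.HasResidue (f + g) (c + d) := by
  rw [HasResidue, map_add, add_sub_add_comm]
  exact Valuation.map_add_lt _ hf hg

theorem HasResidue.neg (hf : P.HasResidue f c) : P.HasResidue (-f) (-c) := by
  rw [HasResidue, map_neg, ← neg_sub', Valuation.map_neg]
  exact hf

theorem HasResidue.sub (hf : P.HasResidue f c) (hg : P.HasResidue g d) :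
    P.HasResidue (f - g) (c - d) := by
  simpa only [sub_eq_add_neg] using hf.add hg.neg

theorem HasResidue.val_le_one (hf : P.HasResidue f c) : P.val f ≤ 1 := by
  have := Valuation.map_add_le P.val hf.le (P.val_algebraMap_le c)
  simpa using this

theorem HasResidue.mem (hf : P.HasResidue f c) : f ∈ P.ring := (P.val_le_one_iff f).mp hf.val_le_one

theorem HasResidue.mul (hf : P.HasResidue f c) (hg : P.HasResidue g d) :
    P.HasResidue (f * g) (c * d) := by
  have h : f * g - algebraMap k K (c * d) =
      f * (g - algebraMap k K d) + (f - algebraMap k K c) * algebraMap k K d := by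
    rw [map_mul]; ring
  rw [HasResidue, h]
  refine Valuation.map_add_lt _ ?_ ?_
  · rw [map_mul]
    exact (mul_le_of_le_one_left' hf.val_le_one).trans_lt hg
  · rw [map_mul]
    exact (mul_le_of_le_one_right' (P.val_algebraMap_le d)).trans_lt hf

theorem HasResidue.pow (hf : P.HasResidue f c) (n : ℕ) : P.HasResidue (f ^ n) (c ^ n) := by
  induction n with
  | zero => simpa using P.hasResidue_algebraMap 1
  | succ n ih => simpa only [pow_succ] using ih.mul hf

theorem HasResidue.val_eq_one (hf : P.HasResidue f c) (hc : c ≠ 0) : P.val f = 1 := by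
  have h1 : P.val (algebraMap k K c) = 1 := P.val_algebraMap hc
  have h2 : P.val (f - algebraMap k K c) < P.val (algebraMap k K c) := by rw [h1]; exact hf
  have := Valuation.map_add_eq_of_lt_left P.val h2
  rwa [add_sub_cancel, h1] at this

theorem HasResidue.inv (hf : P.HasResidue f c) (hc : c ≠ 0) : P.HasResidue f⁻¹ c⁻¹ := by
  have h1 := hf.val_eq_one hc
  have hf0 : f ≠ 0 := by rintro rfl; simp at h1
  have hc0 : algebraMap k K c ≠ 0 := by simpa using hc
  have h : f⁻¹ - algebraMap k K c⁻¹ = -(f - algebraMap k K c) * (f⁻¹ * (algebraMap k K c)⁻¹) := by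
    rw [map_inv₀]; field_simp; ring
  rw [HasResidue, h, map_mul, map_mul, map_inv₀, map_inv₀, h1, P.val_algebraMap hc,
    Valuation.map_neg]
  simpa using! hf

theorem HasResidue.div (hf : P.HasResidue f c) (hg : P.HasResidue g d) (hd : d ≠ 0) :
    P.HasResidue (f / g) (c / d) := by
  simpa only [div_eq_mul_inv] using hf.mul (hg.inv hd)

theorem HasResidue.unique (hc : P.HasResidue f c) (hd : P.HasResidue f d) : c = d := by
  by_contra h
  have h1 := (hc.sub hd).val_eq_one (sub_ne_zero.mpr h)
  simp at h1

theorem hasResidue_zero_iff : P.HasResidue f 0 ↔ P.val f < 1 := by simp [HasResidue]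

end HasResidue

/-- The residue field is one-dimensional exactly when the class of 1 spans it, that is, when every
residue is a constant. -/
theorem degree_eq_one_iff (P : Place k K) :
    P.degree = 1 ↔ ∀ f ∈ P.ring, ∃ c : k, P.HasResidue f c := by
  let _ : Algebra k (IsLocalRing.ResidueField P.ring) := P.constantsToResidueField.toAlgebra
  have hdeg : P.degree = Module.finrank k (IsLocalRing.ResidueField P.ring) := rfl
  rw [hdeg, finrank_eq_one_iff_of_nonzero' (1 : IsLocalRing.ResidueField P.ring) one_ne_zero]
  have key (f : P.ring) (c : k) :
      c • (1 : IsLocalRing.ResidueField P.ring) = IsLocalRing.residue P.ring f ↔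
        P.HasResidue (f : K) c := by
    have h1 : c • (1 : IsLocalRing.ResidueField P.ring) = IsLocalRing.residue P.ring
        ⟨algebraMap k K c, P.algebraMap_mem c⟩ := by
      rw [Algebra.smul_def, mul_one]; rfl
    rw [h1, eq_comm, ← sub_eq_zero, ← map_sub, IsLocalRing.residue_eq_zero_iff,
      ValuationSubring.valuation_lt_one_iff]
    rfl
  constructor
  · intro h f hf
    obtain ⟨c, hc⟩ := h (IsLocalRing.residue P.ring ⟨f, hf⟩)
    exact ⟨c, (key ⟨f, hf⟩ c).mp hc⟩
  · intro h w
    obtain ⟨f, rfl⟩ := IsLocalRing.residue_surjective w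
    obtain ⟨c, hc⟩ := h f f.2
    exact ⟨c, (key f c).mpr hc⟩

/-- Two places are equal if some `t` computes the valuation of all functions at both. -/
theorem eq_of_zpow {P Q : Place k K} {t : K} (hP : P.val t < 1) (hQ : Q.val t < 1)
    (h : ∀ f : K, f ≠ 0 → ∃ n : ℤ, P.val f = P.val t ^ n ∧ Q.val f = Q.val t ^ n) : P = Q := by
  -- If `t` were 0, the powers of its valuation would be only 0 and 1, but a place has functions of
  -- valuation greater than 1.
  have ht0 : t ≠ 0 := by
    rintro rfl
    obtain ⟨f, hf⟩ := P.exists_one_lt_val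
    have hf0 : f ≠ 0 := by rintro rfl; simp at hf
    obtain ⟨n, hn, -⟩ := h f hf0
    rw [hn, map_zero] at hf
    rcases eq_or_ne n 0 with rfl | hn0
    · simp at hf
    · simp [zero_zpow n hn0] at hf
  have key (R : Place k K) (hR : R.val t < 1) (n : ℤ) : R.val t ^ n ≤ 1 ↔ 0 ≤ n := by
    rw [← not_lt, ← not_lt, not_iff_not, ← zpow_zero (R.val t),
      zpow_lt_zpow_iff_right_of_lt_one₀ (R.val_pos ht0) hR]
  refine Place.ext (SetLike.ext fun f => ?_)
  rcases eq_or_ne f 0 with rfl | hf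
  · simp
  · obtain ⟨n, h1, h2⟩ := h f hf
    rw [← P.val_le_one_iff, ← Q.val_le_one_iff, h1, h2, key P hP, key Q hQ]

section smul
variable (σ : K ≃ₐ[k] K) (P : Place k K)

theorem mem_smul_iff (f : K) : f ∈ (σ • P).ring ↔ σ.symm f ∈ P.ring := by
  change f ∈ σ • P.ring ↔ _
  rw [ValuationSubring.mem_smul_pointwise_iff_exists]
  constructor
  · rintro ⟨s, hs, rfl⟩
    simpa using hs
  · exact fun h => ⟨_, h, by simp⟩

theorem apply_mem_smul_iff (f : K) : σ f ∈ (σ • P).ring ↔ f ∈ P.ring := by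
  rw [mem_smul_iff, AlgEquiv.symm_apply_apply]

/-- The valuations of `P` and `σ • P` have different value groups, so they are compared only through
conditions that translate into membership in the valuation rings. -/
theorem val_smul_lt_one_iff (f : K) : (σ • P).val (σ f) < 1 ↔ P.val f < 1 := by
  rw [val_lt_one_iff, val_lt_one_iff, ← map_inv₀, apply_mem_smul_iff]
  simp

theorem hasResidue_smul_iff (f : K) (c : k) : (σ • P).HasResidue (σ f) c ↔ P.HasResidue f c := by
  rw [HasResidue, HasResidue, ← val_smul_lt_one_iff σ P (f - _), map_sub σ, σ.commutes]

theorem degree_smul_eq_one (h : P.degree = 1) : (σ • P).degree = 1 := by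
  rw [degree_eq_one_iff] at h ⊢
  intro f hf
  obtain ⟨c, hc⟩ := h _ ((mem_smul_iff σ P f).mp hf)
  refine ⟨c, ?_⟩
  have := (hasResidue_smul_iff σ P _ c).mpr hc
  rwa [AlgEquiv.apply_symm_apply] at this

/-- The isomorphism of valuation rings induced by an automorphism. -/
def smulRingEquiv : P.ring ≃+* (σ • P).ring where
  toFun f := ⟨σ f, (apply_mem_smul_iff σ P f).mpr f.2⟩
  invFun f := ⟨σ.symm f, (mem_smul_iff σ P f).mp f.2⟩
  left_inv f := Subtype.ext (by simp)
  right_inv f := Subtype.ext (by simp)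
  map_mul' f g := Subtype.ext (by simp)
  map_add' f g := Subtype.ext (by simp)

/-- `HasOrder` speaks only of primes and units of the valuation ring, so the ring isomorphism
induced by `σ` transports it. -/
theorem HasOrder.smul {f : K} {n : ℤ} (h : P.HasOrder f n) : (σ • P).HasOrder (σ f) n := by
  obtain ⟨t, u, ht, rfl⟩ := h
  refine ⟨smulRingEquiv σ P t, Units.mapEquiv (smulRingEquiv σ P).toMulEquiv u,
    (MulEquiv.irreducible_iff (smulRingEquiv σ P)).mpr ht, ?_⟩
  rw [map_mul, map_zpow₀]
  rfl

theorem hasOrder_smul_iff {f : K} {n : ℤ} : (σ • P).HasOrder (σ f) n ↔ P.HasOrder f n := by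
  refine ⟨fun h => ?_, HasOrder.smul σ P⟩
  have := HasOrder.smul σ⁻¹ _ h
  rwa [inv_smul_smul, ← AlgEquiv.mul_apply, inv_mul_cancel] at this

theorem ord_smul (f : K) : (σ • P).ord (σ f) = P.ord f := by
  have h : (σ • P).HasOrder (σ f) = P.HasOrder f := funext fun n => propext (hasOrder_smul_iff σ P)
  unfold ord
  rw [h]

end smul

end Place

theorem Divisor.Equivalent.smul {k K : Type*} [Field k] [Field K] [Algebra k K]
    {P Q R S : Place k K}
    (h : Divisor.Equivalent (P.divisor + Q.divisor) (R.divisor + S.divisor))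
    (σ : K ≃ₐ[k] K) :
    Divisor.Equivalent ((σ • P).divisor + (σ • Q).divisor)
      ((σ • R).divisor + (σ • S).divisor) := by
  obtain ⟨z, hz, h⟩ := h
  refine ⟨σ z, by simpa using hz, fun T => ?_⟩
  have hT := h (σ⁻¹ • T)
  have hord : (σ⁻¹ • T).ord z = T.ord (σ z) := by
    rw [← Place.ord_smul σ, smul_inv_smul]
  classical
  rw [hord] at hT
  simp only [Place.divisor, Finsupp.add_apply, Finsupp.single_apply, eq_inv_smul_iff] at hT ⊢
  exact hT

end EllipticFunctionField
end

/-! ### The place at infinity. -/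

noncomputable section
namespace EllipticFunctionField

theorem Place.HasResidue.aeval {k K : Type*} [Field k] [Field K] [Algebra k K] {P : Place k K}
    {f : K} {c : k} (hf : P.HasResidue f c) (p : Polynomial k) :
    P.HasResidue (Polynomial.aeval f p) (p.eval c) := by
  induction p using Polynomial.induction_on' with
  | add p q hp hq => simpa using hp.add hq
  | monomial n a =>
    rw [Polynomial.aeval_monomial, Polynomial.eval_monomial]
    exact (P.hasResidue_algebraMap a).mul (hf.pow n)

variable {F : Type*} [Field F]

theorem algebraMap_smul_one_add (W : WeierstrassCurve F) (p q : Polynomial F) :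
    algebraMap W.toAffine.CoordinateRing (FunField W)
      (p • 1 + q • WeierstrassCurve.Affine.CoordinateRing.mk W.toAffine Polynomial.X) =
    Polynomial.aeval (coordX W) p + Polynomial.aeval (coordX W) q * coordY W := by
  have h (p : Polynomial F) : algebraMap (Polynomial F) (FunField W) p =
      Polynomial.aeval (coordX W) p := by
    have : (IsScalarTower.toAlgHom F (Polynomial F) (FunField W)) =
        Polynomial.aeval (coordX W) := by
      ext
      simp only [IsScalarTower.coe_toAlgHom', Polynomial.aeval_X]
      rfl
    exact DFunLike.congr_fun this p
  rw [map_add, Algebra.smul_def, Algebra.smul_def, map_mul, map_mul, map_one, mul_one,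
    ← IsScalarTower.algebraMap_apply, ← IsScalarTower.algebraMap_apply, h, h]
  rfl

theorem exists_algebraMap_eq (W : WeierstrassCurve F) (r : W.toAffine.CoordinateRing) :
    ∃ p q : Polynomial F, r = p • 1 +
        q • WeierstrassCurve.Affine.CoordinateRing.mk W.toAffine Polynomial.X ∧
      algebraMap W.toAffine.CoordinateRing (FunField W) r =
        Polynomial.aeval (coordX W) p + Polynomial.aeval (coordX W) q * coordY W := by
  obtain ⟨p, q, rfl⟩ := WeierstrassCurve.Affine.CoordinateRing.exists_smul_basis_eq r
  exact ⟨p, q, rfl, algebraMap_smul_one_add W p q⟩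

namespace Place

variable {W : WeierstrassCurve F} {P : Place F (FunField W)}

/-- If the pole of y were no worse than that of x, every term of the Weierstrass equation other than
x³ would have valuation at most that of x², which is smaller than that of x³. -/
theorem coordX_val_lt_coordY (h : coordX W ∉ P.ring) : P.val (coordX W) < P.val (coordY W) := by
  have hx : 1 < P.val (coordX W) := (P.one_lt_val_iff _).mpr h
  by_contra! hy
  have hc := P.val_algebraMap_le
  set X := P.val (coordX W)
  have hX : 0 < X := zero_lt_one.trans hx
  have h12 : X < X ^ 2 := lt_self_pow₀ hx one_lt_two
  have h1 : P.val (coordY W ^ 2 + algebraMap F _ W.a₁ * coordX W * coordY W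
      + algebraMap F _ W.a₃ * coordY W - algebraMap F _ W.a₂ * coordX W ^ 2
      - algebraMap F _ W.a₄ * coordX W - algebraMap F _ W.a₆) ≤ X ^ 2 := by
    refine Valuation.map_sub_le _ (Valuation.map_sub_le _ (Valuation.map_sub_le _
      (Valuation.map_add_le _ (Valuation.map_add_le _ ?_ ?_) ?_) ?_) ?_) ?_
    · rw [map_pow]; exact pow_le_pow_left₀ zero_le hy 2
    · rw [map_mul, map_mul, sq]
      exact mul_le_mul' (mul_le_of_le_one_left' (hc _)) hy
    · rw [map_mul]
      exact (mul_le_of_le_one_left' (hc _)).trans (hy.trans h12.le)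
    · rw [map_mul, map_pow]
      exact mul_le_of_le_one_left' (hc _)
    · rw [map_mul]
      exact (mul_le_of_le_one_left' (hc _)).trans h12.le
    · exact (hc _).trans (hx.trans h12).le
  have h2 : coordY W ^ 2 + algebraMap F _ W.a₁ * coordX W * coordY W
      + algebraMap F _ W.a₃ * coordY W - algebraMap F _ W.a₂ * coordX W ^ 2
      - algebraMap F _ W.a₄ * coordX W - algebraMap F _ W.a₆ = coordX W ^ 3 := by
    linear_combination coord_equation W
  rw [h2, map_pow] at h1
  exact absurd h1 (not_le.mpr (pow_lt_pow_right₀ hx (by norm_num)))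

theorem coordY_notMem (h : coordX W ∉ P.ring) : coordY W ∉ P.ring := by
  rw [← one_lt_val_iff] at h ⊢
  exact h.trans (coordX_val_lt_coordY ((P.one_lt_val_iff _).mp h))

end Place

theorem coordX_ne_zero (W : WeierstrassCurve F) : coordX W ≠ 0 := fun h =>
  coordX_not_isIntegral W (h ▸ isIntegral_zero)

theorem coordY_ne_zero (W : WeierstrassCurve F) : coordY W ≠ 0 := by
  obtain ⟨P, -, h⟩ := exists_commonPole W
  intro h0
  exact h (h0 ▸ P.ring.zero_mem)

/-- The function `x / y`, a uniformizer at the infinite place. -/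
def infUniformizer (W : WeierstrassCurve F) : FunField W := coordX W / coordY W

theorem infUniformizer_ne_zero (W : WeierstrassCurve F) : infUniformizer W ≠ 0 :=
  div_ne_zero (coordX_ne_zero W) (coordY_ne_zero W)

namespace Place

variable {W : WeierstrassCurve F} {P : Place F (FunField W)}

theorem val_infUniformizer_lt_one (h : coordX W ∉ P.ring) : P.val (infUniformizer W) < 1 := by
  rw [infUniformizer, map_div₀, div_lt_one₀ (P.val_pos (coordY_ne_zero W))]
  exact coordX_val_lt_coordY h

theorem hasResidue_inv_zero {K : Type*} [Field K] [Algebra F K] {P : Place F K} {f : K}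
    (h : f ∉ P.ring) : P.HasResidue f⁻¹ 0 := by
  rw [hasResidue_zero_iff, val_lt_one_iff, inv_inv]
  exact Or.inr h

/-- The equation writes x³/y² as (1 + a₁x/y + a₃/y) / (1 + a₂/x + a₄/x² + a₆/x³), where x/y, 1/y and
1/x all vanish at `P`. With the uniformizer x/y this says that x and y have poles of order 2 and 3
with leading coefficient 1. -/
theorem hasResidue_infUniformizer (h : coordX W ∉ P.ring) :
    P.HasResidue (coordX W ^ 3 / coordY W ^ 2) 1 := by
  have hx := hasResidue_inv_zero h
  have hy := hasResidue_inv_zero (coordY_notMem h)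
  have ht : P.HasResidue (infUniformizer W) 0 :=
    hasResidue_zero_iff.mpr (val_infUniformizer_lt_one h)
  have hc := P.hasResidue_algebraMap
  have hnum := (((hc 1).add ((hc W.a₁).mul ht)).add ((hc W.a₃).mul hy))
  have hden := ((((hc 1).add ((hc W.a₂).mul hx)).add ((hc W.a₄).mul (hx.pow 2)))).add
    ((hc W.a₆).mul (hx.pow 3))
  have key := hnum.div hden (by simp)
  have hx0 := coordX_ne_zero W
  have hy0 := coordY_ne_zero W
  have hden0 : (1 : FunField W) + algebraMap F _ W.a₂ * (coordX W)⁻¹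
      + algebraMap F _ W.a₄ * (coordX W)⁻¹ ^ 2 + algebraMap F _ W.a₆ * (coordX W)⁻¹ ^ 3 ≠ 0 := by
    intro h0
    have := hden.val_eq_one (by simp)
    rw [map_one, h0, map_zero] at this
    exact zero_ne_one this
  have e : (algebraMap F (FunField W) 1 + algebraMap F _ W.a₁ * infUniformizer W
      + algebraMap F _ W.a₃ * (coordY W)⁻¹) /
      (algebraMap F (FunField W) 1 + algebraMap F _ W.a₂ * (coordX W)⁻¹
      + algebraMap F _ W.a₄ * (coordX W)⁻¹ ^ 2 + algebraMap F _ W.a₆ * (coordX W)⁻¹ ^ 3) =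
      coordX W ^ 3 / coordY W ^ 2 := by
    rw [map_one, div_eq_div_iff hden0 (pow_ne_zero 2 hy0), infUniformizer]
    field_simp
    linear_combination coord_equation W
  rw [e] at key
  simpa using key

theorem hasResidue_coordX_mul (h : coordX W ∉ P.ring) :
    P.HasResidue (coordX W * infUniformizer W ^ 2) 1 := by
  convert hasResidue_infUniformizer h using 1
  rw [infUniformizer]
  ring

theorem hasResidue_coordY_mul (h : coordX W ∉ P.ring) :
    P.HasResidue (coordY W * infUniformizer W ^ 3) 1 := by
  convert hasResidue_infUniformizer h using 1
  rw [infUniformizer]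
  field_simp [coordY_ne_zero W]

theorem hasResidue_aeval_coordX_mul (h : coordX W ∉ P.ring) (p : Polynomial F) :
    P.HasResidue (Polynomial.aeval (coordX W) p * infUniformizer W ^ (2 * p.natDegree))
      p.leadingCoeff := by
  -- p(x) is xⁿ times the reversed polynomial at 1/x, and 1/x has residue 0, so only the leading
  -- coefficient of p survives.
  have h1 := (hasResidue_inv_zero h).aeval p.reverse
  rw [← Polynomial.coeff_zero_eq_eval_zero, Polynomial.coeff_zero_reverse] at h1
  have h2 := h1.mul ((hasResidue_coordX_mul h).pow p.natDegree)
  rw [one_pow, mul_one] at h2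
  convert h2 using 1
  let _ := invertibleOfNonzero (coordX_ne_zero W)
  have h3 := Polynomial.eval₂_reverse_mul_pow (algebraMap F (FunField W)) (coordX W) p
  rw [invOf_eq_inv] at h3
  rw [Polynomial.aeval_def, Polynomial.aeval_def, ← h3, mul_pow, pow_mul]
  ring

theorem HasResidue.mul_pow_zero {K : Type*} [Field K] [Algebra F K] {P : Place F K} {f t : K}
    {c : F} (hf : P.HasResidue f c) (ht : P.val t < 1) {n : ℕ} (hn : n ≠ 0) :
    P.HasResidue (f * t ^ n) 0 := by
  simpa [zero_pow hn] using hf.mul ((hasResidue_zero_iff.mpr ht).pow n)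

end Place

/-- For p(x) + q(x)y the two summands have pole orders 2 deg p and 2 deg q + 3, which differ in
parity, so the leading terms cannot cancel. Neither order is 1; this is where the genus enters. The
exponent and the leading coefficient do not depend on `P`, which is what makes the place at infinity
unique. -/
theorem exists_hasResidue_coordinateRing (W : WeierstrassCurve F) {r : W.toAffine.CoordinateRing}
    (hr : r ≠ 0) : ∃ (n : ℕ) (c : F), n ≠ 1 ∧ c ≠ 0 ∧ ∀ P : Place F (FunField W),
      coordX W ∉ P.ring → P.HasResidue (algebraMap _ _ r * infUniformizer W ^ n) c := by
  obtain ⟨p, q, hr', e⟩ := exists_algebraMap_eq W r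
  rw [e]
  rcases eq_or_ne q 0 with rfl | hq
  · have hp : p ≠ 0 := by rintro rfl; simp [hr'] at hr
    refine ⟨2 * p.natDegree, p.leadingCoeff, by omega, by simpa using hp, fun P h => ?_⟩
    simpa using Place.hasResidue_aeval_coordX_mul h p
  rcases lt_or_ge (2 * q.natDegree + 3) (2 * p.natDegree) with hlt | hge
  · refine ⟨2 * p.natDegree, p.leadingCoeff, by omega, ?_, fun P h => ?_⟩
    · rw [Ne, Polynomial.leadingCoeff_eq_zero]
      rintro rfl
      simp at hlt
    have h1 := Place.hasResidue_aeval_coordX_mul h p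
    have h2 := ((Place.hasResidue_aeval_coordX_mul h q).mul
      (Place.hasResidue_coordY_mul h)).mul_pow_zero (Place.val_infUniformizer_lt_one h)
      (n := 2 * p.natDegree - (2 * q.natDegree + 3)) (by omega)
    convert h1.add h2 using 1
    · have : 2 * p.natDegree = (2 * q.natDegree + 3) +
        (2 * p.natDegree - (2 * q.natDegree + 3)) := by omega
      rw [add_mul]
      congr 1
      conv_lhs => rw [this, pow_add, pow_add]
      ring
    · simp
  · refine ⟨2 * q.natDegree + 3, q.leadingCoeff, by omega, by simpa using hq, fun P h => ?_⟩
    have h1 := (Place.hasResidue_aeval_coordX_mul h q).mul (Place.hasResidue_coordY_mul h)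
    have h2 := (Place.hasResidue_aeval_coordX_mul h p).mul_pow_zero
      (Place.val_infUniformizer_lt_one h)
      (n := 2 * q.natDegree + 3 - 2 * p.natDegree) (by omega)
    convert h2.add h1 using 1
    · have : 2 * q.natDegree + 3 = 2 * p.natDegree +
        (2 * q.natDegree + 3 - 2 * p.natDegree) := by omega
      rw [add_mul]
      congr 1
      · conv_lhs => rw [this, pow_add]
        ring
      · rw [pow_add]; ring
    · simp

theorem exists_hasResidue_funField (W : WeierstrassCurve F) {f : FunField W} (hf : f ≠ 0) :
    ∃ (n : ℤ) (c : F), c ≠ 0 ∧ ∀ P : Place F (FunField W),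
      coordX W ∉ P.ring → P.HasResidue (f * infUniformizer W ^ n) c := by
  obtain ⟨r, s, hs, rfl⟩ := IsFractionRing.div_surjective (A := W.toAffine.CoordinateRing) f
  have hs0 : s ≠ 0 := nonZeroDivisors.ne_zero hs
  have hr0 : r ≠ 0 := by rintro rfl; simp at hf
  obtain ⟨m, c, -, hc, hm⟩ := exists_hasResidue_coordinateRing W hr0
  obtain ⟨n, d, -, hd, hn⟩ := exists_hasResidue_coordinateRing W hs0
  refine ⟨(m : ℤ) - n, c / d, div_ne_zero hc hd, fun P h => ?_⟩
  convert (hm P h).div (hn P h) hd using 1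
  rw [zpow_sub₀ (infUniformizer_ne_zero W), zpow_natCast, zpow_natCast, div_mul_div_comm]

namespace Place

variable {W : WeierstrassCurve F} {P Q : Place F (FunField W)}

theorem exists_zpow_infUniformizer (W : WeierstrassCurve F) {f : FunField W} (hf : f ≠ 0) :
    ∃ (n : ℤ), ∀ P : Place F (FunField W), coordX W ∉ P.ring →
      P.val f = P.val (infUniformizer W) ^ n := by
  obtain ⟨n, c, hc, h⟩ := exists_hasResidue_funField W hf
  refine ⟨-n, fun P hP => ?_⟩
  have h1 := (h P hP).val_eq_one hc
  rw [map_mul, map_zpow₀] at h1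
  rw [zpow_neg]
  exact eq_inv_of_mul_eq_one_left h1

theorem isUniformizer_infUniformizer (h : coordX W ∉ P.ring) :
    P.IsUniformizer (infUniformizer W) where
  ne_zero := infUniformizer_ne_zero W
  val_lt_one := val_infUniformizer_lt_one h
  exists_zpow _ hf := (exists_zpow_infUniformizer W hf).imp fun _ hn => hn P h

theorem eq_of_coordX_notMem (hP : coordX W ∉ P.ring) (hQ : coordX W ∉ Q.ring) : P = Q :=
  eq_of_zpow (val_infUniformizer_lt_one hP) (val_infUniformizer_lt_one hQ) fun _ hf =>
    (exists_zpow_infUniformizer W hf).imp fun _ hn => ⟨hn P hP, hn Q hQ⟩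

theorem degree_eq_one_of_coordX_notMem (h : coordX W ∉ P.ring) : P.degree = 1 := by
  rw [degree_eq_one_iff]
  intro f hf
  rcases eq_or_ne f 0 with rfl | hf0
  · exact ⟨0, by simpa using P.hasResidue_algebraMap 0⟩
  have hu := isUniformizer_infUniformizer h
  obtain ⟨n, c, hc, hn⟩ := exists_hasResidue_funField W hf0
  have h1 := hn P h
  have h2 := h1.val_eq_one hc
  have h3 : P.val f = P.val (infUniformizer W) ^ (-n) := by
    rw [map_mul, map_zpow₀] at h2
    rw [zpow_neg]
    exact eq_inv_of_mul_eq_one_left h2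
  have hn0 : n ≤ 0 := by
    by_contra! hn0
    have : P.val (infUniformizer W) ^ (0 : ℤ) < P.val (infUniformizer W) ^ (-n) :=
      hu.zpow_lt_zpow_iff.mpr (by omega)
    rw [zpow_zero, ← h3] at this
    exact (not_le.mpr this) ((P.val_le_one_iff f).mpr hf)
  rcases hn0.lt_or_eq with hlt | rfl
  · refine ⟨0, hasResidue_zero_iff.mpr ?_⟩
    rw [h3, ← zpow_zero (P.val (infUniformizer W)), hu.zpow_lt_zpow_iff]
    omega
  · exact ⟨c, by simpa using h1⟩

end Place

theorem coordX_notMem_infinitePlace (W : WeierstrassCurve F) :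
    coordX W ∉ (infinitePlace W).ring := (exists_commonPole W).choose_spec.1

theorem eq_infinitePlace_iff (W : WeierstrassCurve F) (P : Place F (FunField W)) :
    P = infinitePlace W ↔ coordX W ∉ P.ring := by
  refine ⟨?_, fun h => Place.eq_of_coordX_notMem h (coordX_notMem_infinitePlace W)⟩
  rintro rfl
  exact coordX_notMem_infinitePlace W

end EllipticFunctionField
end

/-! ### Finite places and their centres. -/

noncomputable section
namespace EllipticFunctionField

open WeierstrassCurve.Affine.CoordinateRing (XClass YClass XIdeal YIdeal XYIdeal)

variable {F : Type*} [Field F]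

theorem algebraMap_XClass (W : WeierstrassCurve F) (a : F) :
    algebraMap W.toAffine.CoordinateRing (FunField W) (XClass W.toAffine a) =
      coordX W - algebraMap F _ a := by
  rw [XClass, map_sub, map_sub, map_sub]
  rfl

theorem algebraMap_YClass (W : WeierstrassCurve F) (b : F) :
    algebraMap W.toAffine.CoordinateRing (FunField W) (YClass W.toAffine (Polynomial.C b)) =
      coordY W - algebraMap F _ b := by
  rw [YClass, map_sub, map_sub]
  rfl

/-- The place `P` has the affine point `(a, b)` as its center. -/
structure Place.HasCenter {W : WeierstrassCurve F} (P : Place F (FunField W)) (a b : F) : Prop where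
  coordX : P.HasResidue (coordX W) a
  coordY : P.HasResidue (coordY W) b

theorem coordinateRing_induction (W : WeierstrassCurve F) (A : Subring (FunField W))
    (hF : ∀ c : F, algebraMap F _ c ∈ A) (hx : coordX W ∈ A) (hy : coordY W ∈ A)
    (r : W.toAffine.CoordinateRing) : algebraMap _ (FunField W) r ∈ A := by
  have h (p : Polynomial F) : Polynomial.aeval (coordX W) p ∈ A := by
    induction p using Polynomial.induction_on' with
    | add p q hp hq => simpa using A.add_mem hp hq
    | monomial n a =>
      rw [Polynomial.aeval_monomial]
      exact A.mul_mem (hF a) (A.pow_mem hx n)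
  obtain ⟨p, q, -, e⟩ := exists_algebraMap_eq W r
  rw [e]
  exact A.add_mem (h p) (A.mul_mem (h q) hy)

namespace Place

variable {W : WeierstrassCurve F} {P Q : Place F (FunField W)} {a b : F}

/-- y is a root of a monic quadratic with coefficients in the valuation ring: a pole of y would make
y² larger than all the other terms. -/
theorem coordY_mem (hx : coordX W ∈ P.ring) : coordY W ∈ P.ring := by
  by_contra hy
  have h1 := hasResidue_inv_zero hy
  have hxv := (P.val_le_one_iff _).mpr hx
  have hyv := (P.one_lt_val_iff _).mpr hy
  have hc := P.val_algebraMap_le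
  have h2 : P.val (coordX W ^ 3 + algebraMap F _ W.a₂ * coordX W ^ 2 + algebraMap F _ W.a₄ * coordX W
        + algebraMap F _ W.a₆ - algebraMap F _ W.a₁ * coordX W * coordY W
        - algebraMap F _ W.a₃ * coordY W) ≤ P.val (coordY W) := by
    have hin : coordX W ^ 3 + algebraMap F _ W.a₂ * coordX W ^ 2 + algebraMap F _ W.a₄ * coordX W
        + algebraMap F _ W.a₆ ∈ P.ring := by
      refine add_mem (add_mem (add_mem (pow_mem hx 3) (mul_mem (P.algebraMap_mem _) (pow_mem hx 2)))
        (mul_mem (P.algebraMap_mem _) hx)) (P.algebraMap_mem _)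
    refine Valuation.map_sub_le _ (Valuation.map_sub_le _
      (((P.val_le_one_iff _).mpr hin).trans hyv.le) ?_) ?_
    · rw [map_mul, map_mul]
      exact mul_le_of_le_one_left' (mul_le_one' (hc _) hxv)
    · rw [map_mul]
      exact mul_le_of_le_one_left' (hc _)
  have h3 : coordX W ^ 3 + algebraMap F _ W.a₂ * coordX W ^ 2 + algebraMap F _ W.a₄ * coordX W
        + algebraMap F _ W.a₆ - algebraMap F _ W.a₁ * coordX W * coordY W
        - algebraMap F _ W.a₃ * coordY W = coordY W ^ 2 := by
    linear_combination -coord_equation W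
  rw [h3, map_pow] at h2
  exact absurd h2 (not_le.mpr (lt_self_pow₀ hyv one_lt_two))

theorem coordinateRing_mem (hx : coordX W ∈ P.ring) (r : W.toAffine.CoordinateRing) :
    algebraMap _ (FunField W) r ∈ P.ring :=
  coordinateRing_induction W P.ring.toSubring P.algebraMap_mem hx (coordY_mem hx) r

theorem HasCenter.equation (h : P.HasCenter a b) : W.toAffine.Equation a b := by
  rw [WeierstrassCurve.Affine.equation_iff]
  have hc := P.hasResidue_algebraMap
  have h1 := ((h.coordY.pow 2).add (((hc W.a₁).mul h.coordX).mul h.coordY)).add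
    ((hc W.a₃).mul h.coordY)
  have h2 := (((h.coordX.pow 3).add ((hc W.a₂).mul (h.coordX.pow 2))).add
    ((hc W.a₄).mul h.coordX)).add (hc W.a₆)
  rw [coord_equation] at h1
  exact h1.unique h2

theorem HasCenter.unique {a' b' : F} (h : P.HasCenter a b) (h' : P.HasCenter a' b') :
    a = a' ∧ b = b' := ⟨h.coordX.unique h'.coordX, h.coordY.unique h'.coordY⟩

theorem exists_hasCenter (hP : P.degree = 1) (hx : coordX W ∈ P.ring) :
    ∃ a b, P.HasCenter a b := by
  rw [degree_eq_one_iff] at hP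
  obtain ⟨a, ha⟩ := hP _ hx
  obtain ⟨b, hb⟩ := hP _ (coordY_mem hx)
  exact ⟨a, b, ha, hb⟩

theorem HasCenter.val_lt_one (h : P.HasCenter a b) {r : W.toAffine.CoordinateRing}
    (hr : r ∈ XYIdeal W.toAffine a (Polynomial.C b)) : P.val (algebraMap _ (FunField W) r) < 1 := by
  obtain ⟨s, u, rfl⟩ := Ideal.mem_span_pair.mp hr
  have hm (r) := (P.val_le_one_iff _).mpr (P.coordinateRing_mem h.coordX.mem r)
  rw [map_add, map_mul, map_mul, algebraMap_XClass, algebraMap_YClass]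
  refine Valuation.map_add_lt _ ?_ ?_
  · rw [map_mul]
    exact (mul_le_of_le_one_left' (hm _)).trans_lt h.coordX
  · rw [map_mul]
    exact (mul_le_of_le_one_left' (hm _)).trans_lt h.coordY

end Place

section
variable {W : WeierstrassCurve F} {a b : F}

theorem exists_sub_mem_XYIdeal (h : W.toAffine.Equation a b) (r : W.toAffine.CoordinateRing) :
    ∃ c : F, r - algebraMap F _ c ∈ XYIdeal W.toAffine a (Polynomial.C b) := by
  have h' : (W.toAffine.polynomial.eval (Polynomial.C b)).eval a = 0 := h
  let e := WeierstrassCurve.Affine.CoordinateRing.quotientXYIdealEquiv h'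
  refine ⟨e (Ideal.Quotient.mk _ r), ?_⟩
  rw [← Ideal.Quotient.eq]
  apply e.injective
  change _ = e (algebraMap F _ _)
  rw [e.commutes]
  rfl

theorem XYIdeal_isMaximal (h : W.toAffine.Equation a b) :
    (XYIdeal W.toAffine a (Polynomial.C b)).IsMaximal := by
  have h' : (W.toAffine.polynomial.eval (Polynomial.C b)).eval a = 0 := h
  let e := WeierstrassCurve.Affine.CoordinateRing.quotientXYIdealEquiv h'
  exact Ideal.Quotient.maximal_of_isField _ (e.toMulEquiv.isField (Field.toIsField F))

/-- The maximal ideal of the point is a proper ideal of the coordinate ring, hence lies in the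
non-units of some valuation ring of the function field. -/
theorem exists_hasCenter_place (h : W.toAffine.Equation a b) :
    ∃ P : Place F (FunField W), P.HasCenter a b := by
  have hinj : Function.Injective (algebraMap W.toAffine.CoordinateRing (FunField W)) :=
    IsFractionRing.injective _ _
  let e : W.toAffine.CoordinateRing ≃+* (algebraMap W.toAffine.CoordinateRing (FunField W)).range :=
    RingEquiv.ofBijective (algebraMap W.toAffine.CoordinateRing (FunField W)).rangeRestrict
      ⟨fun r s hrs => hinj (congrArg Subtype.val hrs), RingHom.rangeRestrict_surjective _⟩
  have hI := (XYIdeal_isMaximal h).ne_top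
  obtain ⟨B, hB, hIB⟩ := Ideal.image_subset_nonunits_valuationSubring
    ((XYIdeal W.toAffine a (Polynomial.C b)).comap e.symm.toRingHom)
    (by
      rw [Ne, Ideal.eq_top_iff_one, Ideal.mem_comap, map_one, ← Ideal.eq_top_iff_one]
      exact hI)
  have hmem (r : W.toAffine.CoordinateRing) (hr : r ∈ XYIdeal W.toAffine a (Polynomial.C b)) :
      B.valuation (algebraMap _ (FunField W) r) < 1 := by
    rw [← ValuationSubring.mem_nonunits_iff]
    refine hIB ⟨e r, ?_, rfl⟩
    simpa using hr
  have hX : B.valuation (coordX W - algebraMap F _ a) < 1 := by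
    rw [← algebraMap_XClass]
    exact hmem _ (Ideal.subset_span (by simp))
  have hY : B.valuation (coordY W - algebraMap F _ b) < 1 := by
    rw [← algebraMap_YClass]
    exact hmem _ (Ideal.subset_span (by simp))
  have hF (c : F) : algebraMap F (FunField W) c ∈ B := hB ⟨algebraMap F _ c, rfl⟩
  refine ⟨⟨B, hF, ?_⟩, hX, hY⟩
  -- In the trivial valuation ring the nonzero function x − a would be a unit, yet its valuation is
  -- less than 1.
  rintro rfl
  have hne : coordX W - algebraMap F _ a ≠ 0 := fun h0 =>
    coordX_not_isIntegral W (sub_eq_zero.mp h0 ▸ isIntegral_algebraMap)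
  have hu : IsUnit (⟨coordX W - algebraMap F _ a, trivial⟩ : (⊤ : ValuationSubring (FunField W))) :=
    IsUnit.of_mul_eq_one (⟨(coordX W - algebraMap F _ a)⁻¹, trivial⟩ : (⊤ : ValuationSubring _))
      (Subtype.ext (mul_inv_cancel₀ hne))
  exact hX.ne ((ValuationSubring.valuation_eq_one_iff _ _).mp hu)

end

open Classical in
/-- A local parameter in the coordinate ring at the point `(a, b)`. -/
def localParameter (W : WeierstrassCurve F) (a b : F) : W.toAffine.CoordinateRing :=
  if 2 * b + W.a₁ * a + W.a₃ ≠ 0 then XClass W.toAffine a else YClass W.toAffine (Polynomial.C b)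

section
variable {W : WeierstrassCurve F} {a b : F}

theorem localParameter_mem : localParameter W a b ∈ XYIdeal W.toAffine a (Polynomial.C b) := by
  rw [localParameter]
  split_ifs <;> exact Ideal.subset_span (by simp)

/-- The Weierstrass equation expanded at a point. -/
theorem YClass_mul (h : W.toAffine.Equation a b) :
    YClass W.toAffine (Polynomial.C b) * (YClass W.toAffine (Polynomial.C b) +
        algebraMap F _ W.a₁ * XClass W.toAffine a + algebraMap F _ (2 * b + W.a₁ * a + W.a₃)) =
      XClass W.toAffine a * (XClass W.toAffine a ^ 2
        + algebraMap F _ (3 * a + W.a₂) * XClass W.toAffine a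
        - algebraMap F _ (W.a₁ * b - (3 * a ^ 2 + 2 * W.a₂ * a + W.a₄))) := by
  apply IsFractionRing.injective W.toAffine.CoordinateRing (FunField W)
  rw [WeierstrassCurve.Affine.equation_iff] at h
  have h' := congrArg (algebraMap F (FunField W)) h
  simp only [map_mul, map_add, map_sub, map_pow, algebraMap_XClass, algebraMap_YClass,
    ← IsScalarTower.algebraMap_apply, map_ofNat] at h' ⊢
  linear_combination coord_equation W - h'

theorem algebraMap_notMem_XYIdeal (h : W.toAffine.Equation a b) {c : F} (hc : c ≠ 0) :
    algebraMap F _ c ∉ XYIdeal W.toAffine a (Polynomial.C b) := fun hm =>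
  (XYIdeal_isMaximal h).ne_top (Ideal.eq_top_of_isUnit_mem _ hm ((IsUnit.mk0 c hc).map _))

/-- `YClass_mul` has the form Y · A = X · B, where A and B take at the point, up to sign, the values
of the two partial derivatives of the equation. By nonsingularity one of them does not vanish there;
it serves as `s` and expresses one of X, Y through the other locally. -/
theorem exists_mul_eq_localParameter_mul (h : W.toAffine.Nonsingular a b)
    {r : W.toAffine.CoordinateRing} (hr : r ∈ XYIdeal W.toAffine a (Polynomial.C b)) :
    ∃ s ∉ XYIdeal W.toAffine a (Polynomial.C b), ∃ u, s * r = localParameter W a b * u := by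
  have hX : XClass W.toAffine a ∈ XYIdeal W.toAffine a (Polynomial.C b) :=
    Ideal.subset_span (by simp)
  have hY : YClass W.toAffine (Polynomial.C b) ∈ XYIdeal W.toAffine a (Polynomial.C b) :=
    Ideal.subset_span (by simp)
  have hE := YClass_mul h.1
  set X := XClass W.toAffine a
  set Y := YClass W.toAffine (Polynomial.C b)
  obtain ⟨m, n, rfl⟩ := Ideal.mem_span_pair.mp hr
  rw [WeierstrassCurve.Affine.nonsingular_iff'] at h
  rw [localParameter]
  split_ifs with hb
  · refine ⟨Y + algebraMap F _ W.a₁ * X + algebraMap F _ (2 * b + W.a₁ * a + W.a₃), ?_, m * (Y + algebraMap F _ W.a₁ * X + algebraMap F _ (2 * b + W.a₁ * a + W.a₃))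
      + n * (X ^ 2 + algebraMap F _ (3 * a + W.a₂) * X
        - algebraMap F _ (W.a₁ * b - (3 * a ^ 2 + 2 * W.a₂ * a + W.a₄))), ?_⟩
    · intro hm
      rw [Ideal.add_mem_iff_right _ (Ideal.add_mem _ hY (Ideal.mul_mem_left _ _ hX))] at hm
      exact algebraMap_notMem_XYIdeal h.1 hb hm
    · change _ = X * _
      linear_combination n * hE
  · refine ⟨X ^ 2 + algebraMap F _ (3 * a + W.a₂) * X
        - algebraMap F _ (W.a₁ * b - (3 * a ^ 2 + 2 * W.a₂ * a + W.a₄)), ?_, n * (X ^ 2 + algebraMap F _ (3 * a + W.a₂) * X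
        - algebraMap F _ (W.a₁ * b - (3 * a ^ 2 + 2 * W.a₂ * a + W.a₄)))
      + m * (Y + algebraMap F _ W.a₁ * X + algebraMap F _ (2 * b + W.a₁ * a + W.a₃)), ?_⟩
    · intro hm
      rw [sub_eq_add_neg, Ideal.add_mem_iff_right _ (Ideal.add_mem _ (Ideal.pow_mem_of_mem _ hX 2
        two_pos) (Ideal.mul_mem_left _ _ hX)), Ideal.neg_mem_iff] at hm
      exact algebraMap_notMem_XYIdeal h.1 (h.2.resolve_right hb) hm
    · change _ = Y * _
      linear_combination (-m) * hE

theorem localParameter_ne_zero : localParameter W a b ≠ 0 := by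
  rw [localParameter]
  split_ifs
  · exact WeierstrassCurve.Affine.CoordinateRing.XClass_ne_zero a
  · exact WeierstrassCurve.Affine.CoordinateRing.YClass_ne_zero _

/-- The local ring at the point is a noetherian local domain whose maximal ideal is generated by the
local parameter, hence a discrete valuation ring. The claim is the factorization of `r` into a unit
and a power of the parameter, with denominators cleared. -/
theorem exists_mul_eq_mul_localParameter_pow (h : W.toAffine.Nonsingular a b)
    {r : W.toAffine.CoordinateRing} (hr : r ≠ 0) :
    ∃ s ∉ XYIdeal W.toAffine a (Polynomial.C b), ∃ u ∉ XYIdeal W.toAffine a (Polynomial.C b),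
      ∃ n : ℕ, s * r = u * localParameter W a b ^ n := by
  set I := XYIdeal W.toAffine a (Polynomial.C b) with hI
  have hmax : I.IsMaximal := XYIdeal_isMaximal h.1
  have hprime : I.IsPrime := hmax.isPrime
  let A := Localization.AtPrime I
  have hle : I.primeCompl ≤ nonZeroDivisors W.toAffine.CoordinateRing :=
    I.primeCompl_le_nonZeroDivisors
  have hinj : Function.Injective (algebraMap W.toAffine.CoordinateRing A) :=
    IsLocalization.injective A hle
  have : IsDomain A := IsLocalization.isDomain_of_le_nonZeroDivisors _ hle
  have hnoeth : IsNoetherianRing A := IsLocalization.isNoetherianRing I.primeCompl A inferInstance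
  set t := algebraMap W.toAffine.CoordinateRing A (localParameter W a b) with ht
  have ht0 : t ≠ 0 := (map_ne_zero_iff _ hinj).mpr localParameter_ne_zero
  have hunit (s : W.toAffine.CoordinateRing) (hs : s ∉ I) :
      IsUnit (algebraMap W.toAffine.CoordinateRing A s) :=
    (IsLocalization.AtPrime.isUnit_to_map_iff A I s).mpr hs
  have hmax' : IsLocalRing.maximalIdeal A = Ideal.span {t} := by
    rw [← Localization.AtPrime.map_eq_maximalIdeal]
    refine le_antisymm (Ideal.map_le_iff_le_comap.mpr fun r hr => ?_) ?_
    · obtain ⟨s, hs, u, e⟩ := exists_mul_eq_localParameter_mul h hr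
      rw [Ideal.mem_comap, Ideal.mem_span_singleton, ← (hunit s hs).dvd_mul_left, ← map_mul, e,
        map_mul]
      exact dvd_mul_right _ _
    · rw [Ideal.span_singleton_le_iff_mem]
      exact Ideal.mem_map_of_mem _ localParameter_mem
  have hnf : ¬ IsField A := by
    intro hf
    rw [IsLocalRing.isField_iff_maximalIdeal_eq, hmax', Ideal.span_singleton_eq_bot] at hf
    exact ht0 hf
  have hdvr : IsDiscreteValuationRing A :=
    ((IsDiscreteValuationRing.TFAE A hnf).out 0 4 :).mpr ⟨t, hmax'⟩
  have hirr : Irreducible t := (IsDiscreteValuationRing.irreducible_iff_uniformizer t).mpr hmax'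
  obtain ⟨n, u, e⟩ := IsDiscreteValuationRing.eq_unit_mul_pow_irreducible
    ((map_ne_zero_iff _ hinj).mpr hr) hirr
  obtain ⟨⟨v, s⟩, hvs⟩ := IsLocalization.mk'_surjective I.primeCompl (u : A)
  refine ⟨s, s.2, v, ?_, n, hinj ?_⟩
  · intro hv
    have : IsUnit (IsLocalization.mk' A v s) := by
      rw [show IsLocalization.mk' A v s = u from hvs]; exact u.isUnit
    rw [IsLocalization.AtPrime.isUnit_mk'_iff A I] at this
    exact this hv
  · rw [map_mul, map_mul, map_pow, e, ← ht, ← hvs, ← mul_assoc]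
    congr 1
    exact (mul_comm _ _).trans (IsLocalization.mk'_spec A v s)

end

namespace Place

variable {W : WeierstrassCurve F} {P Q : Place F (FunField W)} {a b : F}

theorem HasCenter.exists_hasResidue (h : P.HasCenter a b) (r : W.toAffine.CoordinateRing) {c : F}
    (hc : r - algebraMap F _ c ∈ XYIdeal W.toAffine a (Polynomial.C b)) :
    P.HasResidue (algebraMap _ (FunField W) r) c := by
  have := h.val_lt_one hc
  rwa [map_sub, ← IsScalarTower.algebraMap_apply] at this

theorem HasCenter.val_eq_one_of_notMem (h : P.HasCenter a b) {r : W.toAffine.CoordinateRing}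
    (hr : r ∉ XYIdeal W.toAffine a (Polynomial.C b)) :
    P.val (algebraMap _ (FunField W) r) = 1 := by
  obtain ⟨c, hc⟩ := exists_sub_mem_XYIdeal h.equation r
  refine (h.exists_hasResidue r hc).val_eq_one ?_
  rintro rfl
  rw [map_zero, sub_zero] at hc
  exact hr hc

/-- The exponent is independent of `P`; together with `eq_of_zpow` this shows that a nonsingular
point is the centre of only one place. -/
theorem exists_zpow_localParameter (h : W.toAffine.Nonsingular a b) {f : FunField W} (hf : f ≠ 0) :
    ∃ n : ℤ, ∀ P : Place F (FunField W), P.HasCenter a b →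
      P.val f = P.val (algebraMap _ (FunField W) (localParameter W a b)) ^ n := by
  have key {r : W.toAffine.CoordinateRing} (hr : r ≠ 0) : ∃ n : ℕ, ∀ P : Place F (FunField W),
      P.HasCenter a b → P.val (algebraMap _ (FunField W) r) =
        P.val (algebraMap _ (FunField W) (localParameter W a b)) ^ n := by
    obtain ⟨s, hs, u, hu, n, e⟩ := exists_mul_eq_mul_localParameter_pow h hr
    refine ⟨n, fun P hP => ?_⟩
    have := congrArg (fun r => P.val (algebraMap _ (FunField W) r)) e
    simpa only [map_mul, map_pow, hP.val_eq_one_of_notMem hs, hP.val_eq_one_of_notMem hu,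
      one_mul] using this
  obtain ⟨r, s, hs, rfl⟩ := IsFractionRing.div_surjective (A := W.toAffine.CoordinateRing) f
  have hs0 : s ≠ 0 := nonZeroDivisors.ne_zero hs
  have hr0 : r ≠ 0 := by rintro rfl; simp at hf
  obtain ⟨m, hm⟩ := key hr0
  obtain ⟨n, hn⟩ := key hs0
  refine ⟨(m : ℤ) - n, fun P hP => ?_⟩
  rw [map_div₀, hm P hP, hn P hP, zpow_sub₀, zpow_natCast, zpow_natCast]
  refine (P.val_pos ?_).ne'
  exact (map_ne_zero_iff _ (IsFractionRing.injective _ _)).mpr localParameter_ne_zero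

theorem HasCenter.isUniformizer (h : P.HasCenter a b) (hab : W.toAffine.Nonsingular a b) :
    P.IsUniformizer (algebraMap _ (FunField W) (localParameter W a b)) where
  ne_zero := (map_ne_zero_iff _ (IsFractionRing.injective _ _)).mpr localParameter_ne_zero
  val_lt_one := h.val_lt_one localParameter_mem
  exists_zpow _ hf := (exists_zpow_localParameter hab hf).imp fun _ hn => hn P h

theorem HasCenter.eq (hP : P.HasCenter a b) (hQ : Q.HasCenter a b)
    (h : W.toAffine.Nonsingular a b) : P = Q :=
  eq_of_zpow (hP.val_lt_one localParameter_mem) (hQ.val_lt_one localParameter_mem) fun _ hf =>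
    (exists_zpow_localParameter h hf).imp fun _ hn => ⟨hn P hP, hn Q hQ⟩

/-- The valuation ring of a place with nonsingular center is the local ring at the center. -/
theorem HasCenter.exists_div (hP : P.HasCenter a b) (h : W.toAffine.Nonsingular a b)
    {f : FunField W} (hf : f ∈ P.ring) : ∃ r : W.toAffine.CoordinateRing, ∃ s ∉ XYIdeal W.toAffine a (Polynomial.C b),
      f = algebraMap _ (FunField W) r / algebraMap _ (FunField W) s := by
  have hinj := IsFractionRing.injective W.toAffine.CoordinateRing (FunField W)
  have hmax := XYIdeal_isMaximal h.1
  have hu := hP.isUniformizer h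
  rcases eq_or_ne f 0 with rfl | hf0
  · exact ⟨0, 1, (Ideal.ne_top_iff_one _).mp hmax.ne_top, by simp⟩
  obtain ⟨r, s, hs, rfl⟩ := IsFractionRing.div_surjective (A := W.toAffine.CoordinateRing) f
  have hs0 : s ≠ 0 := nonZeroDivisors.ne_zero hs
  have hr0 : r ≠ 0 := by rintro rfl; simp at hf0
  obtain ⟨r', hr', u, hu', m, hm⟩ := exists_mul_eq_mul_localParameter_pow h hr0
  obtain ⟨s', hs', v, hv, n, hn⟩ := exists_mul_eq_mul_localParameter_pow h hs0
  have hmk := congrArg (algebraMap _ (FunField W)) hm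
  have hnk := congrArg (algebraMap _ (FunField W)) hn
  rw [map_mul, map_mul, map_pow] at hmk hnk
  have hne {w : W.toAffine.CoordinateRing} (hw : w ∉ XYIdeal W.toAffine a (Polynomial.C b)) :
      algebraMap _ (FunField W) w ≠ 0 := by
    intro h0
    have := hP.val_eq_one_of_notMem hw
    rw [h0, map_zero] at this
    exact zero_ne_one this
  -- Regularity of the quotient forces its exponent m − n to be nonnegative, so the parameter can be
  -- moved to the numerator.
  have hnm : n ≤ m := by
    rw [← P.val_le_one_iff, map_div₀, div_le_one₀ (P.val_pos ((map_ne_zero_iff _ hinj).mpr hs0))] at hf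
    have h1 := congrArg P.val hmk
    have h2 := congrArg P.val hnk
    simp only [map_mul, map_pow, hP.val_eq_one_of_notMem hr', hP.val_eq_one_of_notMem hu',
      hP.val_eq_one_of_notMem hs', hP.val_eq_one_of_notMem hv, one_mul] at h1 h2
    rw [h1, h2] at hf
    by_contra! hlt
    have := hu.zpow_lt_zpow_iff (m := (n : ℤ)) (n := (m : ℤ))
    rw [zpow_natCast, zpow_natCast] at this
    exact not_le.mpr (this.mpr (by exact_mod_cast hlt)) hf
  refine ⟨u * s' * localParameter W a b ^ (m - n), r' * v, ?_, ?_⟩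
  · intro hmem
    exact (hmax.isPrime.mem_or_mem hmem).elim hr' hv
  · rw [div_eq_div_iff ((map_ne_zero_iff _ hinj).mpr hs0)
      (by rw [map_mul]; exact mul_ne_zero (hne hr') (hne hv)), ← map_mul, ← map_mul]
    congr 1
    have ht : localParameter W a b ^ m = localParameter W a b ^ (m - n) * localParameter W a b ^ n := by
      rw [← pow_add, Nat.sub_add_cancel hnm]
    rw [ht] at hm
    linear_combination v * hm - u * localParameter W a b ^ (m - n) * hn

theorem HasCenter.degree_eq_one (hP : P.HasCenter a b) (h : W.toAffine.Nonsingular a b) :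
    P.degree = 1 := by
  rw [degree_eq_one_iff]
  intro f hf
  obtain ⟨r, s, hs, rfl⟩ := hP.exists_div h hf
  obtain ⟨c, hc⟩ := exists_sub_mem_XYIdeal h.1 r
  obtain ⟨d, hd⟩ := exists_sub_mem_XYIdeal h.1 s
  refine ⟨c / d, (hP.exists_hasResidue r hc).div (hP.exists_hasResidue s hd) ?_⟩
  rintro rfl
  rw [map_zero, sub_zero] at hd
  exact hs hd

end Place

end EllipticFunctionField
end

/-! ### The dictionary between rational points and places of degree one. -/

noncomputable section
namespace EllipticFunctionField

open WeierstrassCurve.Affine.CoordinateRing (XClass YClass XIdeal YIdeal XYIdeal)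
open WeierstrassCurve.Affine (Point)

variable {F : Type*} [Field F]

/-- The place of a nonsingular rational point. -/
def placeOf (W : WeierstrassCurve F) : W.toAffine.Point → Place F (FunField W)
  | .zero => infinitePlace W
  | .some _ _ h => (exists_hasCenter_place h.1).choose

section placeOf
variable {W : WeierstrassCurve F}

theorem placeOf_zero : placeOf W 0 = infinitePlace W := rfl

theorem placeOf_some_hasCenter {a b : F} (h : W.toAffine.Nonsingular a b) :
    (placeOf W (.some a b h)).HasCenter a b := (exists_hasCenter_place h.1).choose_spec

theorem Place.HasCenter.eq_placeOf {a b : F} {P : Place F (FunField W)} (hP : P.HasCenter a b)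
    (h : W.toAffine.Nonsingular a b) : P = placeOf W (.some a b h) :=
  hP.eq (placeOf_some_hasCenter h) h

theorem degree_placeOf (p : W.toAffine.Point) : (placeOf W p).degree = 1 := by
  rcases p with _ | ⟨a, b, h⟩
  · exact Place.degree_eq_one_of_coordX_notMem (coordX_notMem_infinitePlace W)
  · exact (placeOf_some_hasCenter h).degree_eq_one h

theorem exists_eq_placeOf [W.IsElliptic] {P : Place F (FunField W)} (hP : P.degree = 1) :
    ∃ p, P = placeOf W p := by
  by_cases hx : coordX W ∈ P.ring
  · obtain ⟨a, b, h⟩ := Place.exists_hasCenter hP hx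
    have hab := WeierstrassCurve.Affine.equation_iff_nonsingular.mp h.equation
    exact ⟨.some a b hab, h.eq_placeOf hab⟩
  · exact ⟨0, (eq_infinitePlace_iff W P).mpr hx⟩

theorem placeOf_injective : Function.Injective (placeOf W) := by
  rintro (_ | ⟨a, b, h⟩) (_ | ⟨a', b', h'⟩) e
  · rfl
  · have := (placeOf_some_hasCenter h').coordX.mem
    rw [← e] at this
    exact absurd this (coordX_notMem_infinitePlace W)
  · have := (placeOf_some_hasCenter h).coordX.mem
    rw [e] at this
    exact absurd this (coordX_notMem_infinitePlace W)
  · have h1 := placeOf_some_hasCenter h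
    rw [e] at h1
    obtain ⟨rfl, rfl⟩ := h1.unique (placeOf_some_hasCenter h')
    rfl

theorem exists_isUniformizer_placeOf (p : W.toAffine.Point) :
    ∃ t, (placeOf W p).IsUniformizer t := by
  rcases p with _ | ⟨a, b, h⟩
  · exact ⟨_, Place.isUniformizer_infUniformizer (coordX_notMem_infinitePlace W)⟩
  · exact ⟨_, (placeOf_some_hasCenter h).isUniformizer h⟩

end placeOf

/-! ### Algebraically closed fields of constants -/

/-- Some r/s has a pole at `P` while r and s are regular, so s vanishes at `P`. Since s is integral
over F[x], it divides a nonzero polynomial in x, which then vanishes too. -/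
theorem Place.exists_val_aeval_lt_one {W : WeierstrassCurve F} {P : Place F (FunField W)}
    (hx : coordX W ∈ P.ring) :
    ∃ p : Polynomial F, p ≠ 0 ∧ P.val (Polynomial.aeval (coordX W) p) < 1 := by
  obtain ⟨f, hf⟩ := P.exists_one_lt_val
  obtain ⟨r, s, hs, rfl⟩ := IsFractionRing.div_surjective (A := W.toAffine.CoordinateRing) f
  have hs0 : s ≠ 0 := nonZeroDivisors.ne_zero hs
  have hsK : algebraMap _ (FunField W) s ≠ 0 :=
    (map_ne_zero_iff _ (IsFractionRing.injective _ _)).mpr hs0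
  have hint : Module.Finite (Polynomial F) W.toAffine.CoordinateRing :=
    Module.Finite.of_basis (WeierstrassCurve.Affine.CoordinateRing.basis W.toAffine)
  obtain ⟨p, hp, u, hu⟩ := ((Algebra.IsIntegral.isIntegral (R := Polynomial F) s).isAlgebraic
    ).exists_nonzero_dvd hs
  refine ⟨p, hp, ?_⟩
  have h1 := algebraMap_smul_one_add W p 0
  simp only [map_zero, zero_smul, zero_mul, add_zero] at h1
  rw [← h1, Algebra.smul_def, mul_one, hu, map_mul, map_mul]
  refine (mul_le_of_le_one_right' ((P.val_le_one_iff _).mpr (coordinateRing_mem hx u))).trans_lt ?_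
  rw [map_div₀, one_lt_div₀ (P.val_pos hsK)] at hf
  exact hf.trans_le ((P.val_le_one_iff _).mpr (coordinateRing_mem hx r))

section IsAlgClosed
variable [IsAlgClosed F] {W : WeierstrassCurve F}

/-- p splits into linear factors; if none of the f − c had valuation below 1, neither would their
product. -/
theorem Place.exists_hasResidue_of_aeval {K : Type*} [Field K] [Algebra F K] {P : Place F K} {f : K}
    {p : Polynomial F} (hp : p ≠ 0) (h : P.val (Polynomial.aeval f p) < 1) :
    ∃ c, P.HasResidue f c := by
  by_contra! hc
  have hs := (IsAlgClosed.splits p).eq_prod_roots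
  rw [hs, map_mul, Polynomial.aeval_C, map_multiset_prod, Multiset.map_map, map_mul,
    P.val_algebraMap (by simpa using hp), one_mul, map_multiset_prod, Multiset.map_map] at h
  refine not_lt.mpr (Multiset.one_le_prod_of_one_le ?_) h
  intro x hx
  obtain ⟨c, -, rfl⟩ := Multiset.mem_map.mp hx
  simpa [HasResidue] using hc c

theorem Place.exists_hasCenter_of_isAlgClosed {P : Place F (FunField W)}
    (hx : coordX W ∈ P.ring) : ∃ a b, P.HasCenter a b := by
  obtain ⟨p, hp, hpP⟩ := exists_val_aeval_lt_one hx
  obtain ⟨a, ha⟩ := exists_hasResidue_of_aeval hp hpP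
  -- The Weierstrass equation with x replaced by its residue a; it differs from the true equation by
  -- a multiple of x − a, so y is a root of q modulo `P`.
  let q : Polynomial F := Polynomial.X ^ 2 + Polynomial.C (W.a₁ * a + W.a₃) * Polynomial.X
    + Polynomial.C (-(a ^ 3 + W.a₂ * a ^ 2 + W.a₄ * a + W.a₆))
  have hq : q.Monic := by simp only [q]; monicity!
  have hc := P.hasResidue_algebraMap
  have hyv := (P.val_le_one_iff _).mpr (coordY_mem hx)
  have hqP : P.val (Polynomial.aeval (coordY W) q) < 1 := by
    have h1 : P.HasResidue (coordX W ^ 3 + algebraMap F _ W.a₂ * coordX W ^ 2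
        + algebraMap F _ W.a₄ * coordX W + algebraMap F _ W.a₆
        - algebraMap F _ (a ^ 3 + W.a₂ * a ^ 2 + W.a₄ * a + W.a₆)) 0 := by
      have := (((((ha.pow 3).add ((hc W.a₂).mul (ha.pow 2))).add
        ((hc W.a₄).mul ha)).add (hc W.a₆))).sub (hc (a ^ 3 + W.a₂ * a ^ 2 + W.a₄ * a + W.a₆))
      rwa [sub_self] at this
    have e : Polynomial.aeval (coordY W) q =
      (coordX W ^ 3 + algebraMap F _ W.a₂ * coordX W ^ 2
        + algebraMap F _ W.a₄ * coordX W + algebraMap F _ W.a₆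
        - algebraMap F _ (a ^ 3 + W.a₂ * a ^ 2 + W.a₄ * a + W.a₆)) -
      algebraMap F _ W.a₁ * coordY W * (coordX W - algebraMap F _ a) := by
      simp only [q, map_add, map_mul, map_pow, map_neg, Polynomial.aeval_X, Polynomial.aeval_C]
      linear_combination coord_equation W
    rw [e]
    refine Valuation.map_sub_lt _ (hasResidue_zero_iff.mp h1) ?_
    rw [map_mul, map_mul]
    exact (mul_le_of_le_one_left' (mul_le_one' (P.val_algebraMap_le _) hyv)).trans_lt ha
  obtain ⟨b, hb⟩ := exists_hasResidue_of_aeval hq.ne_zero hqP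
  exact ⟨a, b, ha, hb⟩

theorem Place.degree_eq_one_of_isAlgClosed [W.IsElliptic] (P : Place F (FunField W)) :
    P.degree = 1 := by
  by_cases hx : coordX W ∈ P.ring
  · obtain ⟨a, b, h⟩ := exists_hasCenter_of_isAlgClosed hx
    exact h.degree_eq_one (WeierstrassCurve.Affine.equation_iff_nonsingular.mp h.equation)
  · exact degree_eq_one_of_coordX_notMem hx

/-- Nullstellensatz: the residue field is finite over the algebraically closed `F`, hence equal to
it, and the images of x and y are the coordinates of the point. -/
theorem exists_eq_XYIdeal_of_isMaximal (M : Ideal W.toAffine.CoordinateRing) [hM : M.IsMaximal] :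
    ∃ a b, W.toAffine.Equation a b ∧ XYIdeal W.toAffine a (Polynomial.C b) ≤ M := by
  let _ := Ideal.Quotient.field M
  have hfin : Module.Finite F (W.toAffine.CoordinateRing ⧸ M) :=
    finite_of_finite_type_of_isJacobsonRing F _
  have hsurj := (IsAlgClosed.algebraMap_bijective_of_isIntegral (k := F)
    (K := W.toAffine.CoordinateRing ⧸ M)).2
  let mk := WeierstrassCurve.Affine.CoordinateRing.mk W.toAffine
  obtain ⟨a, ha⟩ := hsurj (Ideal.Quotient.mk M (mk (Polynomial.C Polynomial.X)))
  obtain ⟨b, hb⟩ := hsurj (Ideal.Quotient.mk M (mk Polynomial.X))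
  have hX : XClass W.toAffine a ∈ M := by
    rw [← Ideal.Quotient.eq_zero_iff_mem, XClass, map_sub, map_sub, map_sub, ← ha, sub_eq_zero]
    rfl
  have hY : YClass W.toAffine (Polynomial.C b) ∈ M := by
    rw [← Ideal.Quotient.eq_zero_iff_mem, YClass, map_sub, map_sub, ← hb, sub_eq_zero]
    rfl
  refine ⟨a, b, ?_, ?_⟩
  · rw [WeierstrassCurve.Affine.equation_iff']
    have h : Ideal.Quotient.mk M (mk W.toAffine.polynomial) = 0 := by
      rw [show mk W.toAffine.polynomial = 0 from AdjoinRoot.mk_self, map_zero]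
    have h' := map_polynomial W ((Ideal.Quotient.mk M).comp mk)
    have hc (c : F) : ((Ideal.Quotient.mk M).comp mk) (Polynomial.C (Polynomial.C c)) =
      algebraMap F _ c := rfl
    simp only [hc] at h'
    simp only [RingHom.comp_apply] at h'
    rw [h, ← ha, ← hb] at h'
    apply (algebraMap F (W.toAffine.CoordinateRing ⧸ M)).injective
    simp only [map_sub, map_add, map_mul, map_pow, map_zero]
    linear_combination -h'
  · rw [XYIdeal, Ideal.span_le]
    rintro r (rfl | rfl)
    · exact hX
    · exact hY

/-- A function without poles outside the infinite place lies in the coordinate ring. -/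
theorem exists_algebraMap_eq_of_forall_mem [W.IsElliptic] {w : FunField W}
    (hw : ∀ P : Place F (FunField W), coordX W ∈ P.ring → w ∈ P.ring) :
    ∃ r : W.toAffine.CoordinateRing, algebraMap _ _ r = w := by
  -- The ideal of denominators of `w`. It lies in no maximal ideal, because at each point `w` can be
  -- written with a denominator that does not vanish there; so it contains 1.
  let I : Ideal W.toAffine.CoordinateRing :=
    { carrier := {s | ∃ r : W.toAffine.CoordinateRing,
        algebraMap _ (FunField W) s * w = algebraMap _ (FunField W) r}
      zero_mem' := ⟨0, by simp⟩
      add_mem' := by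
        rintro s s' ⟨r, hr⟩ ⟨r', hr'⟩
        exact ⟨r + r', by rw [map_add, add_mul, hr, hr', map_add]⟩
      smul_mem' := by
        rintro u s ⟨r, hr⟩
        exact ⟨u * r, by rw [smul_eq_mul, map_mul, mul_assoc, hr, map_mul]⟩ }
  have hI : I = ⊤ := by
    by_contra hne
    obtain ⟨M, hM, hIM⟩ := Ideal.exists_le_maximal I hne
    obtain ⟨a, b, hab, hle⟩ := exists_eq_XYIdeal_of_isMaximal M
    have hns := WeierstrassCurve.Affine.equation_iff_nonsingular.mp hab
    have heq : XYIdeal W.toAffine a (Polynomial.C b) = M :=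
      (XYIdeal_isMaximal hab).eq_of_le hM.ne_top hle
    have hc := placeOf_some_hasCenter hns
    obtain ⟨r, s, hs, hrs⟩ := hc.exists_div hns (hw _ hc.coordX.mem)
    refine hs (heq ▸ hIM ⟨r, ?_⟩)
    have hs0 : algebraMap _ (FunField W) s ≠ 0 := by
      intro h0
      have := hc.val_eq_one_of_notMem hs
      rw [h0, map_zero] at this
      exact zero_ne_one this
    rw [hrs, mul_div_cancel₀ _ hs0]
  obtain ⟨r, hr⟩ : (1 : W.toAffine.CoordinateRing) ∈ I := hI ▸ trivial
  exact ⟨r, by rw [← hr, map_one, one_mul]⟩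

end IsAlgClosed

end EllipticFunctionField
end

/-! ### Extension of the constants to the algebraic closure. -/

noncomputable section
namespace EllipticFunctionField

open WeierstrassCurve.Affine (Point)

variable {F : Type*} [Field F]

/-- Every valuation ring extends along a homomorphism of fields. -/
theorem exists_valuationSubring_comap_eq {K L : Type*} [Field K] [Field L] (φ : K →+* L)
    (V : ValuationSubring K) : ∃ B : ValuationSubring L, B.comap φ = V := by
  let ψ : V →+* L := φ.comp V.subtype
  have hloc : IsLocalRing ψ.range := .of_surjective' ψ.rangeRestrict ψ.rangeRestrict_surjective
  -- A valuation ring dominating the image of `V`. Domination yields equality of the restriction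
  -- with `V`: if z is not in `V`, then z⁻¹ is a non-unit of `V`, so its image cannot be inverted in
  -- `B`.
  obtain ⟨B, hle, hB⟩ := LocalSubring.exists_le_valuationSubring (.mk ψ.range)
  have hmem (z : K) (hz : z ∈ V) : φ z ∈ B := hle ⟨⟨z, hz⟩, rfl⟩
  refine ⟨B, SetLike.ext fun z => ⟨fun hzB => ?_, hmem z⟩⟩
  rw [ValuationSubring.mem_comap] at hzB
  by_contra hz
  have hz0 : z ≠ 0 := by rintro rfl; exact hz V.zero_mem
  have hinv : z⁻¹ ∈ V := (V.mem_or_inv_mem z).resolve_left hz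
  have hu : IsUnit (⟨φ z⁻¹, hmem _ hinv⟩ : B) :=
    IsUnit.of_mul_eq_one ⟨φ z, hzB⟩ (Subtype.ext (by
      change φ z⁻¹ * φ z = 1
      rw [← map_mul, inv_mul_cancel₀ hz0, map_one]))
  have hu' := hB.map_nonunit (⟨φ z⁻¹, ⟨⟨z⁻¹, hinv⟩, rfl⟩⟩ : ψ.range) hu
  obtain ⟨⟨_, ⟨⟨w, hwV⟩, rfl⟩⟩, hv⟩ := isUnit_iff_exists_inv.mp hu'
  have hv' : φ z⁻¹ * φ w = 1 := congrArg Subtype.val hv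
  rw [← map_mul, map_eq_one_iff _ φ.injective] at hv'
  exact hz ((eq_inv_of_mul_eq_one_right hv').trans (inv_inv z) ▸ hwV)

/-- Valuation rings are integrally closed, so one containing `F` also contains the algebraic
extension. -/
theorem mem_valuationSubring_of_isIntegral {F A L : Type*} [Field F] [Field A] [Algebra F A]
    [Algebra.IsIntegral F A] [Field L] (B : ValuationSubring L) (φ : A →+* L)
    (h : ∀ c : F, φ (algebraMap F A c) ∈ B) (c : A) : φ c ∈ B := by
  have hint : IsIntegral B (φ c) := by
    obtain ⟨p, hp, hpc⟩ := Algebra.IsIntegral.isIntegral (R := F) c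
    refine ⟨p.map ((φ.comp (algebraMap F A)).codRestrict B h), hp.map _, ?_⟩
    rw [Polynomial.eval₂_map]
    have hcomp : (algebraMap B L).comp ((φ.comp (algebraMap F A)).codRestrict B h) =
        φ.comp (algebraMap F A) := RingHom.ext fun c => rfl
    rw [hcomp, ← Polynomial.hom_eval₂, hpc, map_zero]
  obtain ⟨v, hv⟩ := (IsIntegrallyClosed.isIntegral_iff (R := B)).mp hint
  rw [← hv]
  exact v.2

section toGeom
variable (W : WeierstrassCurve F)

theorem toGeom_algebraMap_coordinateRing (r : W.toAffine.CoordinateRing) :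
    toGeom W (algebraMap _ _ r) = algebraMap _ _
      (WeierstrassCurve.Affine.CoordinateRing.map W.toAffine
        (algebraMap F (AlgebraicClosure F)) r) := by
  rw [toGeom, IsFractionRing.map, IsLocalization.map_eq]

theorem toGeom_coordX : toGeom W (coordX W) = coordX (geomCurve W) := by
  rw [coordX, toGeom_algebraMap_coordinateRing, WeierstrassCurve.Affine.CoordinateRing.map_mk,
    Polynomial.map_C, Polynomial.coe_mapRingHom, Polynomial.map_X]
  rfl

theorem toGeom_coordY : toGeom W (coordY W) = coordY (geomCurve W) := by
  rw [coordY, toGeom_algebraMap_coordinateRing, WeierstrassCurve.Affine.CoordinateRing.map_mk,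
    Polynomial.map_X]
  rfl

theorem toGeom_algebraMap (c : F) : toGeom W (algebraMap F _ c) =
    algebraMap (AlgebraicClosure F) _ (algebraMap F (AlgebraicClosure F) c) := by
  have h : algebraMap F (FunField W) c = algebraMap W.toAffine.CoordinateRing _
    (WeierstrassCurve.Affine.CoordinateRing.mk W.toAffine (Polynomial.C (Polynomial.C c))) := rfl
  rw [h, toGeom_algebraMap_coordinateRing, WeierstrassCurve.Affine.CoordinateRing.map_mk,
    Polynomial.map_C, Polynomial.coe_mapRingHom, Polynomial.map_C]
  rfl

theorem toGeom_aeval (f : FunField W) (p : Polynomial F) : toGeom W (Polynomial.aeval f p) =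
    Polynomial.aeval (toGeom W f) (p.map (algebraMap F (AlgebraicClosure F))) := by
  induction p using Polynomial.induction_on' with
  | add p q hp hq => simp [hp, hq]
  | monomial n a =>
    rw [Polynomial.aeval_monomial, map_mul, map_pow, toGeom_algebraMap, Polynomial.map_monomial,
      Polynomial.aeval_monomial]

theorem toGeom_ne_zero {f : FunField W} (hf : f ≠ 0) : toGeom W f ≠ 0 :=
  (map_ne_zero (toGeom W)).mpr hf

end toGeom

namespace Place

variable {W : WeierstrassCurve F}

theorem exists_aeval_eval_eq_zero (a : AlgebraicClosure F) :
    ∃ p : Polynomial F, p ≠ 0 ∧ (p.map (algebraMap F (AlgebraicClosure F))).eval a = 0 := by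
  have h := Algebra.IsIntegral.isIntegral (R := F) a
  exact ⟨minpoly F a, minpoly.ne_zero h, by
    rw [Polynomial.eval_map_algebraMap, minpoly.aeval]⟩

theorem aeval_coordX_ne_zero {p : Polynomial F} (hp : p ≠ 0) :
    Polynomial.aeval (coordX W) p ≠ 0 := fun h =>
  coordX_not_isIntegral W (isAlgebraic_iff_isIntegral.mp ⟨p, hp, h⟩)

/-- The restriction to `F(x, y)` of a place of the constant field extension. -/
def restrict (P : Place (AlgebraicClosure F) (FunField (geomCurve W))) : Place F (FunField W) where
  ring := P.ring.comap (toGeom W)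
  algebraMap_mem c := by
    rw [ValuationSubring.mem_comap, toGeom_algebraMap]
    exact P.algebraMap_mem _
  ne_top h := by
    have hall (z : FunField W) : toGeom W z ∈ P.ring := by
      rw [← ValuationSubring.mem_comap, h]
      trivial
    have hx : coordX (geomCurve W) ∈ P.ring := toGeom_coordX W ▸ hall _
    obtain ⟨a, b, hP⟩ := exists_hasCenter_of_isAlgClosed hx
    -- The residue a of x is algebraic over `F`. If p is its minimal polynomial, p(x) is nonzero and
    -- vanishes at `P`, so its inverse is outside the ring.
    obtain ⟨p, hp, hpa⟩ := exists_aeval_eval_eq_zero a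
    have h1 := hP.coordX.aeval (p.map (algebraMap F (AlgebraicClosure F)))
    rw [hpa, ← toGeom_coordX, ← toGeom_aeval, hasResidue_zero_iff, val_lt_one_iff,
      ← map_inv₀] at h1
    rcases h1 with h1 | h1
    · exact toGeom_ne_zero W (aeval_coordX_ne_zero hp) h1
    · exact h1 (hall _)

variable (P : Place (AlgebraicClosure F) (FunField (geomCurve W)))

theorem mem_restrict {z : FunField W} : z ∈ P.restrict.ring ↔ toGeom W z ∈ P.ring := Iff.rfl

theorem val_restrict_lt_one_iff {z : FunField W} :
    P.restrict.val z < 1 ↔ P.val (toGeom W z) < 1 := by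
  rw [val_lt_one_iff, val_lt_one_iff, mem_restrict, map_inv₀, map_eq_zero]

theorem val_restrict_le_one_iff {z : FunField W} :
    P.restrict.val z ≤ 1 ↔ P.val (toGeom W z) ≤ 1 := by
  rw [val_le_one_iff, val_le_one_iff, mem_restrict]

theorem val_restrict_eq_one_iff {z : FunField W} :
    P.restrict.val z = 1 ↔ P.val (toGeom W z) = 1 := by
  have h := P.val_restrict_lt_one_iff (z := z)
  rw [le_antisymm_iff, le_antisymm_iff, val_restrict_le_one_iff]
  exact and_congr Iff.rfl (by rw [← not_lt, h, not_lt])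

theorem hasResidue_restrict_iff {z : FunField W} {c : F} :
    P.restrict.HasResidue z c ↔
      P.HasResidue (toGeom W z) (algebraMap F (AlgebraicClosure F) c) := by
  rw [HasResidue, HasResidue, val_restrict_lt_one_iff, map_sub, toGeom_algebraMap]

theorem coordX_mem_restrict_iff :
    coordX W ∈ P.restrict.ring ↔ coordX (geomCurve W) ∈ P.ring := by
  rw [mem_restrict, toGeom_coordX]

theorem hasCenter_restrict_iff {a b : F} : P.restrict.HasCenter a b ↔
    P.HasCenter (algebraMap F (AlgebraicClosure F) a) (algebraMap F (AlgebraicClosure F) b) := by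
  constructor
  · rintro ⟨h1, h2⟩
    rw [hasResidue_restrict_iff, toGeom_coordX] at h1
    rw [hasResidue_restrict_iff, toGeom_coordY] at h2
    exact ⟨h1, h2⟩
  · rintro ⟨h1, h2⟩
    constructor
    · rwa [hasResidue_restrict_iff, toGeom_coordX]
    · rwa [hasResidue_restrict_iff, toGeom_coordY]

/-- Every place of `F(x, y)` extends to the constant field extension. -/
theorem exists_restrict_eq (Q : Place F (FunField W)) :
    ∃ P : Place (AlgebraicClosure F) (FunField (geomCurve W)), P.restrict = Q := by
  obtain ⟨B, hB⟩ := exists_valuationSubring_comap_eq (toGeom W) Q.ring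
  have hmem' (z : FunField W) : toGeom W z ∈ B ↔ z ∈ Q.ring := by
    rw [← hB, ValuationSubring.mem_comap]
  have hmem (z : FunField W) (hz : z ∈ Q.ring) : toGeom W z ∈ B := (hmem' z).mpr hz
  have hF := mem_valuationSubring_of_isIntegral (F := F) B
    (algebraMap (AlgebraicClosure F) (FunField (geomCurve W))) fun c => by
      rw [← toGeom_algebraMap]
      exact hmem _ (Q.algebraMap_mem c)
  have hne : B ≠ ⊤ := fun h => Q.ne_top (top_le_iff.mp fun z _ => (hmem' z).mp (by
    rw [h]; exact ValuationSubring.mem_top _))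
  exact ⟨⟨B, hF, hne⟩, Place.ext hB⟩

variable {P}

/-- The orders at `P` of functions from F(x, y) form a nontrivial subgroup of ℤ; a function
realizing the least positive order is a uniformizer of the restriction. -/
theorem exists_isUniformizer_restrict {s : FunField (geomCurve W)} (hs : P.IsUniformizer s) :
    ∃ t, P.restrict.IsUniformizer t := by
  have hex : ∃ n : ℕ, n ≠ 0 ∧ ∃ f : FunField W, f ≠ 0 ∧ P.val (toGeom W f) = P.val s ^ n := by
    obtain ⟨f, hf⟩ := P.restrict.exists_one_lt_val
    have hf0 : f ≠ 0 := by rintro rfl; simp at hf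
    have hf1 : P.restrict.val f⁻¹ < 1 := by
      rw [map_inv₀]; exact inv_lt_one_of_one_lt₀ hf
    rw [val_restrict_lt_one_iff] at hf1
    obtain ⟨n, hn⟩ := hs.exists_zpow _ (toGeom_ne_zero W (inv_ne_zero hf0))
    rw [hn, ← zpow_zero (P.val s), hs.zpow_lt_zpow_iff] at hf1
    lift n to ℕ using hf1.le
    rw [zpow_natCast] at hn
    exact ⟨n, by rintro rfl; simp at hf1, f⁻¹, inv_ne_zero hf0, hn⟩
  classical
  obtain ⟨hn0, t, ht0, ht⟩ := Nat.find_spec hex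
  have hmin := @Nat.find_min _ _ hex
  set n := Nat.find hex with hn
  have hs0 := (P.val_pos hs.ne_zero).ne'
  refine ⟨t, ht0, ?_, fun f hf => ?_⟩
  · rw [val_restrict_lt_one_iff, ht]
    exact pow_lt_one₀ zero_le hs.val_lt_one hn0
  · obtain ⟨m, hm⟩ := hs.exists_zpow _ (toGeom_ne_zero W hf)
    have hval : P.val (toGeom W (f / t ^ (m / n))) = P.val s ^ (m % n) := by
      rw [map_div₀, map_zpow₀, map_div₀, map_zpow₀, hm, ht, ← zpow_natCast (P.val s) n, ← zpow_mul,
        ← zpow_sub₀ hs0, ← Int.emod_def]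
    have hnn : (0 : ℤ) ≤ m % n := Int.emod_nonneg _ (by exact_mod_cast hn0)
    have hlt : m % n < n := Int.emod_lt_of_pos _ (by omega)
    -- Division with remainder: a nonzero remainder would be a smaller positive order.
    have hz : m % n = 0 := by
      by_contra hne
      refine hmin (m := (m % n).toNat) (by omega) ⟨by omega, f / t ^ (m / n),
        div_ne_zero hf (zpow_ne_zero _ ht0), ?_⟩
      rw [hval, ← zpow_natCast, Int.toNat_of_nonneg hnn]
    rw [hz, zpow_zero, ← val_restrict_eq_one_iff, map_div₀, map_zpow₀, div_eq_one_iff_eq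
      (zpow_ne_zero _ (P.restrict.val_pos ht0).ne')] at hval
    exact ⟨_, hval⟩

/-- The valuation ring of any place is discrete. -/
theorem exists_isUniformizer [W.IsElliptic] (Q : Place F (FunField W)) :
    ∃ t, Q.IsUniformizer t := by
  obtain ⟨P, rfl⟩ := Q.exists_restrict_eq
  obtain ⟨p, rfl⟩ := exists_eq_placeOf P.degree_eq_one_of_isAlgClosed
  obtain ⟨s, hs⟩ := exists_isUniformizer_placeOf p
  exact exists_isUniformizer_restrict hs

/-- There is no function whose only pole is a simple pole at the infinite place. -/
theorem ord_infinitePlace_ne_neg_one [W.IsElliptic] {w : FunField W} (hw0 : w ≠ 0)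
    (hw : ∀ Q : Place F (FunField W), coordX W ∈ Q.ring → w ∈ Q.ring) :
    (infinitePlace W).ord w ≠ -1 := by
  intro hord
  -- Over the algebraic closure `w` has no finite poles, so it lies in the coordinate ring, where
  -- pole order 1 at infinity is excluded by `exists_hasResidue_coordinateRing`.
  obtain ⟨r, hr⟩ := exists_algebraMap_eq_of_forall_mem (W := geomCurve W) (w := toGeom W w)
    fun P hP => P.mem_restrict.mp (hw _ (P.coordX_mem_restrict_iff.mpr hP))
  have hr0 : r ≠ 0 := by
    rintro rfl
    rw [map_zero] at hr
    exact toGeom_ne_zero W hw0 hr.symm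
  obtain ⟨n, c, hn, hc, h⟩ := exists_hasResidue_coordinateRing (geomCurve W) hr0
  have hO := coordX_notMem_infinitePlace (geomCurve W)
  have hO' : (infinitePlace (geomCurve W)).restrict = infinitePlace W := by
    rw [eq_infinitePlace_iff, coordX_mem_restrict_iff]
    exact hO
  have hu := isUniformizer_infUniformizer (coordX_notMem_infinitePlace W)
  have hu' := isUniformizer_infUniformizer hO
  have h1 : (infinitePlace W).val (w * infUniformizer W) = 1 := by
    rw [map_mul, hu.val_eq_zpow_ord hw0, hord, zpow_neg_one,
      inv_mul_cancel₀ ((infinitePlace W).val_pos hu.ne_zero).ne']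
  have ht : toGeom W (infUniformizer W) = infUniformizer (geomCurve W) := by
    rw [infUniformizer, map_div₀, toGeom_coordX, toGeom_coordY]; rfl
  rw [← hO', val_restrict_eq_one_iff, map_mul, ht, map_mul] at h1
  have h2 := (h _ hO).val_eq_one hc
  rw [map_mul, hr, map_pow] at h2
  have h0 := ((infinitePlace (geomCurve W)).val_pos (toGeom_ne_zero W hw0)).ne'
  have h3 := mul_left_cancel₀ h0 (h2.trans h1.symm)
  have h4 : (n : ℤ) = 1 := hu'.zpow_injective (by rw [zpow_one, zpow_natCast]; exact h3)
  omega

end Place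

end EllipticFunctionField
end

noncomputable section
namespace EllipticFunctionField

open WeierstrassCurve.Affine.CoordinateRing (XClass YClass XIdeal YIdeal XYIdeal)
open WeierstrassCurve.Affine (Point)

variable {F : Type*} [Field F]

/-! ### Values of ideals at finite places -/

/-- `γ` is the largest valuation at `P` of an element of the ideal `I`. -/
def Place.IsIdealValue {W : WeierstrassCurve F} (P : Place F (FunField W))
    (I : Ideal W.toAffine.CoordinateRing) (γ : P.ring.ValueGroup) : Prop :=
  (∀ r ∈ I, P.val (algebraMap _ (FunField W) r) ≤ γ) ∧
    ∃ r ∈ I, P.val (algebraMap _ (FunField W) r) = γ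

namespace Place
variable {W : WeierstrassCurve F} {P : Place F (FunField W)}
  {I J : Ideal W.toAffine.CoordinateRing} {γ δ : P.ring.ValueGroup}

theorem IsIdealValue.unique (h : P.IsIdealValue I γ) (h' : P.IsIdealValue I δ) : γ = δ := by
  obtain ⟨h1, r, hr, rfl⟩ := h
  obtain ⟨h2, s, hs, rfl⟩ := h'
  exact le_antisymm (h2 r hr) (h1 s hs)

/-- Multiplicativity turns identities between products of point ideals and principal ideals into the
divisors of the line functions. -/
theorem IsIdealValue.mul (h : P.IsIdealValue I γ) (h' : P.IsIdealValue J δ) :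
    P.IsIdealValue (I * J) (γ * δ) := by
  obtain ⟨h1, r, hr, hrγ⟩ := h
  obtain ⟨h2, s, hs, hsδ⟩ := h'
  refine ⟨fun u hu => ?_, r * s, Ideal.mul_mem_mul hr hs, by rw [map_mul, map_mul, hrγ, hsδ]⟩
  induction hu using Submodule.mul_induction_on' with
  | mem_mul_mem m hm n hn =>
    rw [map_mul, map_mul]
    exact mul_le_mul' (h1 m hm) (h2 n hn)
  | add m _ n _ hm hn =>
    rw [map_add]
    exact Valuation.map_add_le _ hm hn

theorem isIdealValue_span_singleton (hx : coordX W ∈ P.ring) (r : W.toAffine.CoordinateRing) :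
    P.IsIdealValue (Ideal.span {r}) (P.val (algebraMap _ (FunField W) r)) := by
  refine ⟨fun s hs => ?_, r, Ideal.mem_span_singleton_self r, rfl⟩
  obtain ⟨u, rfl⟩ := Ideal.mem_span_singleton'.mp hs
  rw [map_mul, map_mul]
  exact mul_le_of_le_one_left' ((P.val_le_one_iff _).mpr (coordinateRing_mem hx u))

theorem isIdealValue_XYIdeal_self {a b : F} (hP : P.HasCenter a b)
    (h : W.toAffine.Nonsingular a b) {t : FunField W} (ht : P.IsUniformizer t) :
    P.IsIdealValue (XYIdeal W.toAffine a (Polynomial.C b)) (P.val t) := by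
  have hu := hP.isUniformizer h
  have key (f : FunField W) (hf : P.val f < 1) {s : FunField W} (hs : P.IsUniformizer s) :
      P.val f ≤ P.val s := by
    rcases eq_or_ne f 0 with rfl | hf0
    · simp
    obtain ⟨n, hn⟩ := hs.exists_zpow f hf0
    rw [hn, ← zpow_zero (P.val s), hs.zpow_lt_zpow_iff] at hf
    rw [hn]
    by_contra! hlt
    nth_rewrite 1 [← zpow_one (P.val s)] at hlt
    rw [hs.zpow_lt_zpow_iff] at hlt
    omega
  exact ⟨fun r hr => key _ (hP.val_lt_one hr) ht, _, localParameter_mem,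
    le_antisymm (key _ hu.val_lt_one ht) (key _ ht.val_lt_one hu)⟩

/-- If every element of the ideal vanished at `P`, so would x − a and y − b, making (a, b) the
centre. -/
theorem isIdealValue_XYIdeal_of_ne {a b : F} (hx : coordX W ∈ P.ring) (hP : ¬ P.HasCenter a b) :
    P.IsIdealValue (XYIdeal W.toAffine a (Polynomial.C b)) 1 := by
  refine ⟨fun r _ => (P.val_le_one_iff _).mpr (coordinateRing_mem hx r), ?_⟩
  by_contra! hne
  have hlt (r) (hr : r ∈ XYIdeal W.toAffine a (Polynomial.C b)) :
      P.val (algebraMap _ (FunField W) r) < 1 :=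
    lt_of_le_of_ne ((P.val_le_one_iff _).mpr (coordinateRing_mem hx r)) (hne r hr)
  refine hP ⟨?_, ?_⟩
  · rw [HasResidue, ← algebraMap_XClass]
    exact hlt _ (Ideal.subset_span (by simp))
  · rw [HasResidue, ← algebraMap_YClass]
    exact hlt _ (Ideal.subset_span (by simp))

end Place

open Classical in
/-- The multiplicity of the place of an affine point `p` at the place `P`. -/
def pointMult {W : WeierstrassCurve F} (p : W.toAffine.Point) (P : Place F (FunField W)) : ℤ :=
  if P = placeOf W p then 1 else 0

/-! ### Divisors of lines. -/

section lines
variable {W : WeierstrassCurve F}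

theorem isIdealValue_XYIdeal {a b : F} (h : W.toAffine.Nonsingular a b) {P : Place F (FunField W)}
    (hx : coordX W ∈ P.ring) {t : FunField W} (ht : P.IsUniformizer t) :
    P.IsIdealValue (XYIdeal W.toAffine a (Polynomial.C b)) (P.val t ^ pointMult (.some a b h) P) := by
  rw [pointMult]
  split_ifs with hP
  · rw [zpow_one]
    have hc : P.HasCenter a b := hP ▸ placeOf_some_hasCenter h
    exact Place.isIdealValue_XYIdeal_self hc h ht
  · rw [zpow_zero]
    exact Place.isIdealValue_XYIdeal_of_ne hx fun hc => hP (hc.eq_placeOf h)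

theorem pointMult_zero_of_coordX_mem {P : Place F (FunField W)} (hx : coordX W ∈ P.ring) :
    pointMult (0 : W.toAffine.Point) P = 0 := by
  rw [pointMult, if_neg]
  rintro rfl
  exact coordX_notMem_infinitePlace W hx

theorem pointMult_infinitePlace_some {a b : F} (h : W.toAffine.Nonsingular a b) :
    pointMult (.some a b h) (infinitePlace W) = 0 := by
  rw [pointMult, if_neg]
  intro e
  exact Point.some_ne_zero h (placeOf_injective (e.symm.trans placeOf_zero.symm))

theorem pointMult_infinitePlace_zero :
    pointMult (0 : W.toAffine.Point) (infinitePlace W) = 1 := by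
  rw [pointMult, placeOf_zero, if_pos rfl]

theorem divisor_placeOf_apply (p : W.toAffine.Point) (P : Place F (FunField W)) :
    (placeOf W p).divisor P = pointMult p P := by
  classical
  rw [Place.divisor, Finsupp.single_apply, pointMult]
  simp only [eq_comm]

/-- Criterion for linear equivalence in terms of valuations. -/
theorem equivalent_placeOf_of_val [W.IsElliptic] {p q r s : W.toAffine.Point} {z : FunField W}
    (hz : z ≠ 0)
    (hfin : ∀ (P : Place F (FunField W)) (t : FunField W), coordX W ∈ P.ring → P.IsUniformizer t →
      P.val z = P.val t ^ (pointMult p P + pointMult q P - pointMult r P - pointMult s P))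
    (hinf : (infinitePlace W).val z = (infinitePlace W).val (infUniformizer W) ^
      (pointMult p (infinitePlace W) + pointMult q (infinitePlace W)
        - pointMult r (infinitePlace W) - pointMult s (infinitePlace W))) :
    Divisor.Equivalent ((placeOf W p).divisor + (placeOf W q).divisor)
      ((placeOf W r).divisor + (placeOf W s).divisor) := by
  refine ⟨z, hz, fun P => ?_⟩
  simp only [Finsupp.add_apply, divisor_placeOf_apply]
  suffices P.ord z = pointMult p P + pointMult q P - pointMult r P - pointMult s P by omega
  by_cases hx : coordX W ∈ P.ring
  · obtain ⟨t, ht⟩ := P.exists_isUniformizer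
    exact ht.ord_eq hz (hfin P t hx ht)
  · obtain rfl := (eq_infinitePlace_iff W P).mpr hx
    exact (Place.isUniformizer_infUniformizer hx).ord_eq hz hinf

theorem val_infinitePlace_coordX_sub (a : F) :
    (infinitePlace W).val (coordX W - algebraMap F _ a) =
      (infinitePlace W).val (infUniformizer W) ^ (-2 : ℤ) := by
  have hO := coordX_notMem_infinitePlace W
  have ht := infUniformizer_ne_zero W
  have h := Place.hasResidue_aeval_coordX_mul hO (Polynomial.X - Polynomial.C a)
  rw [Polynomial.leadingCoeff_X_sub_C, Polynomial.natDegree_X_sub_C] at h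
  have h1 := h.val_eq_one one_ne_zero
  rw [map_mul, map_pow] at h1
  simp only [map_sub, Polynomial.aeval_X, Polynomial.aeval_C] at h1
  rw [zpow_neg]
  exact eq_inv_of_mul_eq_one_left h1

theorem val_infinitePlace_coordY_sub (p : Polynomial F) (hp : p.natDegree ≤ 1) :
    (infinitePlace W).val (coordY W - Polynomial.aeval (coordX W) p) =
      (infinitePlace W).val (infUniformizer W) ^ (-3 : ℤ) := by
  have hO := coordX_notMem_infinitePlace W
  have h1 := Place.hasResidue_coordY_mul hO
  have h2 := (Place.hasResidue_aeval_coordX_mul hO p).mul_pow_zero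
    (Place.val_infUniformizer_lt_one hO) (n := 3 - 2 * p.natDegree) (by omega)
  rw [mul_assoc, ← pow_add, show 2 * p.natDegree + (3 - 2 * p.natDegree) = 3 by omega] at h2
  have h3 := (h1.sub h2).val_eq_one (by simp)
  rw [← sub_mul, map_mul, map_pow] at h3
  rw [zpow_neg]
  exact eq_inv_of_mul_eq_one_left h3

open Classical in
/-- The group law on points computes sums of places. -/
theorem equivalent_placeOf_add [W.IsElliptic] (p q : W.toAffine.Point) :
    Divisor.Equivalent ((placeOf W p).divisor + (placeOf W q).divisor)
      ((placeOf W (p + q)).divisor + (placeOf W 0).divisor) := by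
  have refl (A : Divisor F (FunField W)) : Divisor.Equivalent A A :=
    ⟨1, one_ne_zero, fun P => by rw [P.ord_eq_zero_of_val_eq_one (map_one _), add_zero]⟩
  rcases p with _ | ⟨x₁, y₁, h₁⟩
  · change Divisor.Equivalent (_ + _) ((placeOf W (0 + q)).divisor + _)
    rw [zero_add, add_comm]
    exact refl _
  rcases q with _ | ⟨x₂, y₂, h₂⟩
  · change Divisor.Equivalent (_ + _) ((placeOf W (_ + 0)).divisor + _)
    rw [add_zero]
    exact refl _
  by_cases hxy : x₁ = x₂ ∧ y₁ = W.toAffine.negY x₂ y₂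
  · obtain ⟨rfl, rfl⟩ := hxy
    rw [Point.add_of_Y_eq rfl rfl]
    -- Opposite points: the vertical line through them has zeros there and a double pole at
    -- infinity.
    refine equivalent_placeOf_of_val (z := coordX W - algebraMap F _ x₁)
      (fun h0 => coordX_not_isIntegral W (sub_eq_zero.mp h0 ▸ isIntegral_algebraMap))
      (fun P t hx ht => ?_) ?_
    · have h := (isIdealValue_XYIdeal h₁ hx ht).mul (isIdealValue_XYIdeal h₂ hx ht)
      rw [WeierstrassCurve.Affine.CoordinateRing.XYIdeal_neg_mul h₂, XIdeal] at h
      rw [← algebraMap_XClass, pointMult_zero_of_coordX_mem hx, sub_zero, sub_zero,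
        zpow_add₀ (P.val_pos ht.ne_zero).ne']
      exact (Place.isIdealValue_span_singleton hx _).unique h
    · rw [val_infinitePlace_coordX_sub, pointMult_infinitePlace_some, pointMult_infinitePlace_some,
        pointMult_infinitePlace_zero]
      rfl
  · rw [Point.add_some hxy]
    have hprod := WeierstrassCurve.Affine.CoordinateRing.XYIdeal_mul_XYIdeal h₁.1 h₂.1 hxy
    set x₃ := W.toAffine.addX x₁ x₂ (W.toAffine.slope x₁ x₂ y₁ y₂)
    set ℓ := WeierstrassCurve.Affine.linePolynomial x₁ y₁ (W.toAffine.slope x₁ x₂ y₁ y₂) with hℓ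
    have hX0 : algebraMap _ (FunField W) (XClass W.toAffine x₃) ≠ 0 :=
      (map_ne_zero_iff _ (IsFractionRing.injective _ _)).mpr
        (WeierstrassCurve.Affine.CoordinateRing.XClass_ne_zero x₃)
    have hY0 : algebraMap _ (FunField W) (YClass W.toAffine ℓ) ≠ 0 :=
      (map_ne_zero_iff _ (IsFractionRing.injective _ _)).mpr
        (WeierstrassCurve.Affine.CoordinateRing.YClass_ne_zero ℓ)
    -- The chord or tangent over the vertical line through its third intersection point. At infinity
    -- the orders −3 and −2 leave a simple pole; at finite places the value is read off from
    -- `XYIdeal_mul_XYIdeal`.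
    refine equivalent_placeOf_of_val (z := algebraMap _ (FunField W) (YClass W.toAffine ℓ) /
      algebraMap _ (FunField W) (XClass W.toAffine x₃)) (div_ne_zero hY0 hX0)
      (fun P t hx ht => ?_) ?_
    · have hl := (Place.isIdealValue_span_singleton hx (XClass W.toAffine x₃)).mul
        ((isIdealValue_XYIdeal h₁ hx ht).mul (isIdealValue_XYIdeal h₂ hx ht))
      have hr := (Place.isIdealValue_span_singleton hx (YClass W.toAffine ℓ)).mul
        (isIdealValue_XYIdeal
          (WeierstrassCurve.Affine.nonsingular_add h₁ h₂ hxy) hx ht)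
      rw [XIdeal, YIdeal] at hprod
      rw [hprod] at hl
      have h := hl.unique hr
      have hv := (P.val_pos ht.ne_zero).ne'
      rw [pointMult_zero_of_coordX_mem hx, sub_zero, zpow_sub₀ hv, zpow_add₀ hv, map_div₀,
        div_eq_div_iff (P.val_pos hX0).ne' (zpow_ne_zero _ hv), mul_comm _ (P.val _), h]
    · have hYe : algebraMap _ (FunField W) (YClass W.toAffine ℓ) =
          coordY W - Polynomial.aeval (coordX W) ℓ := by
        have h := algebraMap_smul_one_add W ℓ 0
        simp only [map_zero, zero_smul, zero_mul, add_zero] at h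
        rw [YClass, map_sub, map_sub, ← h, WeierstrassCurve.Affine.CoordinateRing.smul, mul_one]
        rfl
      have hdeg : ℓ.natDegree ≤ 1 := by
        rw [hℓ, WeierstrassCurve.Affine.linePolynomial]
        compute_degree
      rw [map_div₀, algebraMap_XClass, hYe, val_infinitePlace_coordX_sub,
        val_infinitePlace_coordY_sub ℓ hdeg, pointMult_infinitePlace_some,
        pointMult_infinitePlace_some, pointMult_infinitePlace_some, pointMult_infinitePlace_zero,
        ← zpow_sub₀ ((infinitePlace W).val_pos (infUniformizer_ne_zero W)).ne']
      rfl

end lines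

end EllipticFunctionField
end

/-! ### Linear equivalence expressed in the group of points. -/

noncomputable section
namespace EllipticFunctionField

open WeierstrassCurve.Affine (Point)

variable {F : Type*} [Field F]

theorem Place.ord_mul {W : WeierstrassCurve F} [W.IsElliptic] (P : Place F (FunField W))
    {f g : FunField W} (hf : f ≠ 0) (hg : g ≠ 0) : P.ord (f * g) = P.ord f + P.ord g := by
  obtain ⟨t, ht⟩ := P.exists_isUniformizer
  refine ht.ord_eq (mul_ne_zero hf hg) ?_
  rw [map_mul, ht.val_eq_zpow_ord hf, ht.val_eq_zpow_ord hg,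
    zpow_add₀ (P.val_pos ht.ne_zero).ne']

theorem Place.ord_inv {W : WeierstrassCurve F} [W.IsElliptic] (P : Place F (FunField W))
    {f : FunField W} (hf : f ≠ 0) : P.ord f⁻¹ = -P.ord f := by
  have h := P.ord_mul hf (inv_ne_zero hf)
  rw [mul_inv_cancel₀ hf, P.ord_eq_zero_of_val_eq_one (map_one _)] at h
  omega

theorem Place.mem_of_ord_nonneg {W : WeierstrassCurve F} [W.IsElliptic] (P : Place F (FunField W))
    {f : FunField W} (hf : f ≠ 0) (h : 0 ≤ P.ord f) : f ∈ P.ring := by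
  obtain ⟨t, ht⟩ := P.exists_isUniformizer
  rw [← P.val_le_one_iff, ht.val_eq_zpow_ord hf, ← not_lt, ← zpow_zero (P.val t),
    ht.zpow_lt_zpow_iff]
  omega

namespace Divisor.Equivalent

variable {W : WeierstrassCurve F} {A B C : Divisor F (FunField W)}

theorem of_add_right (h : Divisor.Equivalent (A + C) (B + C)) : Divisor.Equivalent A B := by
  obtain ⟨z, hz, h⟩ := h
  refine ⟨z, hz, fun P => ?_⟩
  have := h P
  simp only [Finsupp.add_apply] at this
  omega

variable [W.IsElliptic]

theorem symm (h : Divisor.Equivalent A B) : Divisor.Equivalent B A := by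
  obtain ⟨z, hz, h⟩ := h
  refine ⟨z⁻¹, inv_ne_zero hz, fun P => ?_⟩
  rw [h P, P.ord_inv hz]
  omega

theorem trans (h : Divisor.Equivalent A B) (h' : Divisor.Equivalent B C) :
    Divisor.Equivalent A C := by
  obtain ⟨z, hz, h⟩ := h
  obtain ⟨w, hw, h'⟩ := h'
  refine ⟨z * w, mul_ne_zero hz hw, fun P => ?_⟩
  rw [h P, h' P, P.ord_mul hz hw]
  omega

theorem add {D : Divisor F (FunField W)} (h : Divisor.Equivalent A B)
    (h' : Divisor.Equivalent C D) : Divisor.Equivalent (A + C) (B + D) := by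
  obtain ⟨z, hz, h⟩ := h
  obtain ⟨w, hw, h'⟩ := h'
  refine ⟨z * w, mul_ne_zero hz hw, fun P => ?_⟩
  rw [Finsupp.add_apply, Finsupp.add_apply, h P, h' P, P.ord_mul hz hw]
  omega

end Divisor.Equivalent

section
variable {W : WeierstrassCurve F} [W.IsElliptic]

/-- Otherwise the function realizing the equivalence would have a simple pole at infinity and no
other pole. -/
theorem eq_zero_of_equivalent {p : W.toAffine.Point}
    (h : Divisor.Equivalent (placeOf W p).divisor (placeOf W 0).divisor) : p = 0 := by
  by_contra hp
  obtain ⟨z, hz, h⟩ := h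
  simp only [divisor_placeOf_apply] at h
  refine Place.ord_infinitePlace_ne_neg_one (w := z) hz (fun P hP => ?_) ?_
  · refine P.mem_of_ord_nonneg hz ?_
    have := h P
    rw [pointMult_zero_of_coordX_mem hP, zero_add] at this
    rw [← this, pointMult]
    split_ifs <;> omega
  · have := h (infinitePlace W)
    rw [pointMult_infinitePlace_zero] at this
    rcases p with _ | ⟨a, b, hab⟩
    · exact absurd rfl hp
    · rw [pointMult_infinitePlace_some] at this
      omega

open Classical in
/-- Linear equivalence of sums of two rational places in terms of the group of points. -/
theorem equivalent_placeOf_iff (p q r s : W.toAffine.Point) :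
    Divisor.Equivalent ((placeOf W p).divisor + (placeOf W q).divisor)
      ((placeOf W r).divisor + (placeOf W s).divisor) ↔ p + q = r + s := by
  constructor
  · intro h
    have h1 : Divisor.Equivalent (placeOf W (p + q)).divisor (placeOf W (r + s)).divisor :=
      (((equivalent_placeOf_add p q).symm.trans h).trans
        (equivalent_placeOf_add r s)).of_add_right
    -- Adding the place of −(r + s) to both sides moves the question to whether one point is zero,
    -- which `eq_zero_of_equivalent` decides.
    have h2 := equivalent_placeOf_add (p + q) (-(r + s))
    have h3 := equivalent_placeOf_add (r + s) (-(r + s))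
    rw [add_neg_cancel] at h3
    have refl : Divisor.Equivalent (placeOf W (-(r + s))).divisor
        (placeOf W (-(r + s))).divisor :=
      ⟨1, one_ne_zero, fun P => by rw [P.ord_eq_zero_of_val_eq_one (map_one _), add_zero]⟩
    have h4 := ((h2.symm.trans (h1.add refl)).trans h3).of_add_right
    have h5 := eq_zero_of_equivalent h4
    rwa [← sub_eq_add_neg, sub_eq_zero] at h5
  · intro h
    refine (equivalent_placeOf_add p q).trans ?_
    rw [h]
    exact (equivalent_placeOf_add r s).symm

open Classical in
theorem isSum_placeOf_iff (p q r : W.toAffine.Point) :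
    IsSum W (placeOf W p) (placeOf W q) (placeOf W r) ↔ r = p + q := by
  rw [IsSum, ← placeOf_zero, equivalent_placeOf_iff, add_zero, eq_comm]

open Classical in
theorem placeAdd_placeOf (p q : W.toAffine.Point) :
    placeAdd W (placeOf W p) (placeOf W q) = placeOf W (p + q) := by
  have h : ∃ R : Place F (FunField W), R.degree = 1 ∧ IsSum W (placeOf W p) (placeOf W q) R :=
    ⟨_, degree_placeOf _, (isSum_placeOf_iff p q _).mpr rfl⟩
  rw [placeAdd, dif_pos h]
  obtain ⟨h1, h2⟩ := h.choose_spec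
  obtain ⟨r, hr⟩ := exists_eq_placeOf h1
  rw [hr] at h2 ⊢
  rw [(isSum_placeOf_iff p q r).mp h2]

/-- The rational point whose place is the image of the place of `p` under `σ`. -/
theorem exists_smul_placeOf_eq (σ : FunField W ≃ₐ[F] FunField W) (p : W.toAffine.Point) :
    ∃ q, σ • placeOf W p = placeOf W q :=
  exists_eq_placeOf (Place.degree_smul_eq_one σ _ (degree_placeOf p))

open Classical in
/-- Automorphisms act on points by affine maps. -/
theorem add_eq_add_of_smul_placeOf_eq {σ : FunField W ≃ₐ[F] FunField W}
    {φ : W.toAffine.Point → W.toAffine.Point} (hφ : ∀ p, σ • placeOf W p = placeOf W (φ p))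
    (p q : W.toAffine.Point) : φ p + φ q = φ (p + q) + φ 0 := by
  have h := (equivalent_placeOf_add p q).smul σ
  rwa [hφ, hφ, hφ, hφ, equivalent_placeOf_iff] at h

end

/-! ### Rational points over the algebraic closure -/

section
variable [IsAlgClosed F] (W : WeierstrassCurve F)

theorem exists_equation (a : F) : ∃ b, W.toAffine.Equation a b := by
  let q : Polynomial F := Polynomial.X ^ 2 + Polynomial.C (W.a₁ * a + W.a₃) * Polynomial.X
    + Polynomial.C (-(a ^ 3 + W.a₂ * a ^ 2 + W.a₄ * a + W.a₆))
  have hq : q.degree = 2 := by simp only [q]; compute_degree!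
  obtain ⟨b, hb⟩ := IsAlgClosed.exists_root q (by rw [hq]; norm_num)
  refine ⟨b, ?_⟩
  rw [WeierstrassCurve.Affine.equation_iff]
  simp only [q, Polynomial.IsRoot.def, Polynomial.eval_add, Polynomial.eval_mul,
    Polynomial.eval_pow, Polynomial.eval_X, Polynomial.eval_C] at hb
  linear_combination hb

theorem infinite_point [W.IsElliptic] : Infinite W.toAffine.Point := by
  choose b hb using exists_equation W
  have : Infinite F := IsAlgClosed.instInfinite
  refine Infinite.of_injective (fun a => (.some a (b a)
    (WeierstrassCurve.Affine.equation_iff_nonsingular.mp (hb a)) : W.toAffine.Point))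
    fun a a' h => ?_
  injection h

variable {W} [W.IsElliptic]

/-- A function which vanishes at all finite places is zero. -/
theorem eq_zero_of_forall_val_lt_one {f : FunField W}
    (hf : ∀ P : Place F (FunField W), coordX W ∈ P.ring → P.val f < 1) : f = 0 := by
  by_contra hf0
  obtain ⟨r, rfl⟩ := exists_algebraMap_eq_of_forall_mem fun P hP =>
    (P.val_le_one_iff f).mp (hf P hP).le
  have hr0 : r ≠ 0 := by rintro rfl; simp at hf0
  have hint : Module.Finite (Polynomial F) W.toAffine.CoordinateRing :=
    Module.Finite.of_basis (WeierstrassCurve.Affine.CoordinateRing.basis W.toAffine)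
  obtain ⟨p, hp, u, hu⟩ := ((Algebra.IsIntegral.isIntegral (R := Polynomial F) r).isAlgebraic
    ).exists_nonzero_dvd (mem_nonZeroDivisors_of_ne_zero hr0)
  have h1 := algebraMap_smul_one_add W p 0
  simp only [map_zero, zero_smul, zero_mul, add_zero] at h1
  have : Infinite F := IsAlgClosed.instInfinite
  -- `r` divides the polynomial p in x, so at a point whose x-coordinate is not a root of p the
  -- function `r` cannot vanish.
  obtain ⟨a, ha⟩ : ∃ a, p.eval a ≠ 0 := by
    by_contra! h
    exact hp (Polynomial.funext (by simpa using h))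
  obtain ⟨b, hb⟩ := exists_equation W a
  have hc := placeOf_some_hasCenter (WeierstrassCurve.Affine.equation_iff_nonsingular.mp hb)
  have h2 := (hc.coordX.aeval p).val_eq_one ha
  rw [← h1, Algebra.smul_def, mul_one, hu, map_mul, map_mul] at h2
  exact ((mul_le_of_le_one_right' ((Place.val_le_one_iff _ _).mpr
    (Place.coordinateRing_mem hc.coordX.mem u))).trans_lt (hf _ hc.coordX.mem)).ne h2

end

theorem funField_hom_ext {W : WeierstrassCurve F} {L : Type*} [Field L]
    {φ ψ : FunField W →+* L} (h : ∀ c : F, φ (algebraMap F _ c) = ψ (algebraMap F _ c))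
    (hx : φ (coordX W) = ψ (coordX W)) (hy : φ (coordY W) = ψ (coordY W)) : φ = ψ := by
  ext f
  obtain ⟨r, s, -, rfl⟩ := IsFractionRing.div_surjective (A := W.toAffine.CoordinateRing) f
  have key := coordinateRing_induction W (φ.eqLocus ψ) h hx hy
  rw [map_div₀, map_div₀, show φ _ = ψ _ from key r, show φ _ = ψ _ from key s]

theorem funField_algEquiv_ext {W : WeierstrassCurve F} {σ τ : FunField W ≃ₐ[F] FunField W}
    (hx : σ (coordX W) = τ (coordX W)) (hy : σ (coordY W) = τ (coordY W)) : σ = τ := by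
  have := funField_hom_ext (φ := (σ : FunField W →+* FunField W))
    (ψ := (τ : FunField W →+* FunField W)) (fun c => by simp) hx hy
  exact AlgEquiv.ext fun z => DFunLike.congr_fun this z

/-- If ρ fixes `P`, then f and ρ f have the same residue there. Hence ρ x − x and ρ y − y vanish at
every finite place and are zero. -/
theorem eq_one_of_forall_smul_eq [IsAlgClosed F] {W : WeierstrassCurve F} [W.IsElliptic]
    {ρ : FunField W ≃ₐ[F] FunField W} (h : ∀ P : Place F (FunField W), ρ • P = P) : ρ = 1 := by
  have key {f : FunField W} (hf : ∀ P : Place F (FunField W), coordX W ∈ P.ring →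
      ∃ c, P.HasResidue f c) : ρ f = f := by
    refine sub_eq_zero.mp (eq_zero_of_forall_val_lt_one fun P hP => ?_)
    obtain ⟨c, hc⟩ := hf P hP
    have hc' := (Place.hasResidue_smul_iff ρ P f c).mpr hc
    rw [h] at hc'
    simpa [Place.HasResidue] using hc'.sub hc
  refine funField_algEquiv_ext (key fun P hP => ?_) (key fun P hP => ?_)
  · obtain ⟨a, b, hab⟩ := Place.exists_hasCenter_of_isAlgClosed hP
    exact ⟨a, hab.coordX⟩
  · obtain ⟨a, b, hab⟩ := Place.exists_hasCenter_of_isAlgClosed hP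
    exact ⟨b, hab.coordY⟩

end EllipticFunctionField
end

/-! ### Homomorphisms out of the function field, and translations from the generic point. -/

noncomputable section
namespace EllipticFunctionField

open WeierstrassCurve.Affine (Point)
open scoped WeierstrassCurve.Affine

variable {F : Type*} [Field F]

theorem exists_algHom {W : WeierstrassCurve F} {L : Type*} [Field L] [Algebra F L] {x y : L}
    (he : y ^ 2 + algebraMap F _ W.a₁ * x * y + algebraMap F _ W.a₃ * y =
      x ^ 3 + algebraMap F _ W.a₂ * x ^ 2 + algebraMap F _ W.a₄ * x + algebraMap F _ W.a₆)
    (hx : ¬ IsIntegral F x) :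
    ∃ φ : FunField W →ₐ[F] L, φ (coordX W) = x ∧ φ (coordY W) = y := by
  have h0 : W.toAffine.polynomial.eval₂ (Polynomial.aeval x : Polynomial F →ₐ[F] L).toRingHom y
      = 0 := by
    have := map_polynomial W
      (Polynomial.eval₂RingHom (Polynomial.aeval x : Polynomial F →ₐ[F] L).toRingHom y)
    simp only [Polynomial.coe_eval₂RingHom, Polynomial.eval₂_X, Polynomial.eval₂_C,
      AlgHom.toRingHom_eq_coe, RingHom.coe_coe, Polynomial.aeval_X, Polynomial.aeval_C] at this
    rw [AlgHom.toRingHom_eq_coe, this]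
    linear_combination he
  let g : W.toAffine.CoordinateRing →+* L := AdjoinRoot.lift _ y h0
  have hgp (p : Polynomial F) : g (algebraMap (Polynomial F) _ p) = Polynomial.aeval x p :=
    AdjoinRoot.lift_of h0
  -- A nonzero element of the kernel would divide a nonzero polynomial in the coordinate function,
  -- and that polynomial would then annihilate the transcendental `x`.
  have hg : Function.Injective g := by
    rw [injective_iff_map_eq_zero]
    intro r hr
    by_contra hr0
    have hint : Module.Finite (Polynomial F) W.toAffine.CoordinateRing :=
      Module.Finite.of_basis (WeierstrassCurve.Affine.CoordinateRing.basis W.toAffine)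
    obtain ⟨p, hp, u, hu⟩ := ((Algebra.IsIntegral.isIntegral (R := Polynomial F) r).isAlgebraic
      ).exists_nonzero_dvd (mem_nonZeroDivisors_of_ne_zero hr0)
    have h1 := hgp p
    rw [hu, map_mul, hr, zero_mul] at h1
    exact hx (isAlgebraic_iff_isIntegral.mp ⟨p, hp, h1.symm⟩)
  let φ : FunField W →+* L := IsFractionRing.lift hg
  have hφ (r : W.toAffine.CoordinateRing) : φ (algebraMap _ _ r) = g r :=
    IsFractionRing.lift_algebraMap hg r
  refine ⟨{ φ with commutes' := fun c => ?_ }, ?_, ?_⟩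
  · change φ (algebraMap W.toAffine.CoordinateRing _
      (algebraMap (Polynomial F) _ (Polynomial.C c))) = _
    rw [hφ, hgp, Polynomial.aeval_C]
  · change φ (algebraMap W.toAffine.CoordinateRing _
      (algebraMap (Polynomial F) _ Polynomial.X)) = _
    rw [hφ, hgp, Polynomial.aeval_X]
  · change φ (algebraMap W.toAffine.CoordinateRing _ (AdjoinRoot.root _)) = _
    rw [hφ]
    exact AdjoinRoot.lift_root h0

/-- The homomorphism on points induced by a homomorphism of fields. -/
def mapPoint [DecidableEq F] (W : WeierstrassCurve F) {L : Type*} [Field L] [DecidableEq L] (f : F →+* L) :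
    W.toAffine.Point →+ (W.map f).toAffine.Point where
  toFun P := match P with
    | 0 => 0
    | .some _ _ h => .some _ _ <| (W.toAffine.map_nonsingular f.injective ..).mpr h
  map_zero' := rfl
  map_add' := by
    rintro (_ | ⟨x₁, y₁, h₁⟩) (_ | ⟨x₂, y₂, h₂⟩)
    any_goals rfl
    by_cases hxy : x₁ = x₂ ∧ y₁ = W.toAffine.negY x₂ y₂
    · rw [Point.add_of_Y_eq hxy.left hxy.right,
        Point.add_of_Y_eq (congr_arg _ hxy.left) <| by
          rw [hxy.right, WeierstrassCurve.Affine.map_negY]]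
    · have hxy' : ¬ (f x₁ = f x₂ ∧ f y₁ = (W.map f).toAffine.negY (f x₂) (f y₂)) := fun h =>
        hxy ⟨f.injective h.1, f.injective (WeierstrassCurve.Affine.map_negY (W' := W.toAffine)
          f x₂ y₂ ▸ h.2)⟩
      rw [Point.add_some hxy]
      refine Eq.trans ?_ (Point.add_some hxy').symm
      simp only [← WeierstrassCurve.Affine.map_addX, ← WeierstrassCurve.Affine.map_addY,
        ← WeierstrassCurve.Affine.map_slope]

/-! ### The generic point -/

theorem isIntegral_of_equation {W : WeierstrassCurve F} {L : Type*} [Field L] [Algebra F L] {x y : L}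
    (he : y ^ 2 + algebraMap F _ W.a₁ * x * y + algebraMap F _ W.a₃ * y =
      x ^ 3 + algebraMap F _ W.a₂ * x ^ 2 + algebraMap F _ W.a₄ * x + algebraMap F _ W.a₆)
    (hx : IsIntegral F x) : IsIntegral F y := by
  let A := integralClosure F L
  let a : F → A := algebraMap F A
  let x' : A := ⟨x, hx⟩
  have : IsIntegral A y := by
    refine ⟨Polynomial.X ^ 2 + Polynomial.C (a W.a₁ * x' + a W.a₃) * Polynomial.X
      - Polynomial.C (x' ^ 3 + a W.a₂ * x' ^ 2 + a W.a₄ * x' + a W.a₆), by monicity!, ?_⟩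
    simp only [Polynomial.eval₂_sub, Polynomial.eval₂_add, Polynomial.eval₂_mul,
      Polynomial.eval₂_pow, Polynomial.eval₂_X, Polynomial.eval₂_C, map_add, map_mul, map_pow]
    have e1 (c : F) : algebraMap A L (a c) = algebraMap F L c := rfl
    have e2 : algebraMap A L x' = x := rfl
    simp only [e1, e2]
    linear_combination he
  exact isIntegral_trans y this

/-- The slope of the line through the generic point and a rational point `(c, d)`. -/
def genericSlope (W : WeierstrassCurve F) (c d : F) : FunField W :=
  (coordY W - algebraMap F _ d) / (coordX W - algebraMap F _ c)

theorem coordX_ne_algebraMap {W : WeierstrassCurve F} (c : F) : coordX W ≠ algebraMap F _ c := fun h =>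
  coordX_not_isIntegral W (h ▸ isIntegral_algebraMap)

open Classical in
/-- A rational point as a point over the function field. -/
def constPoint (W : WeierstrassCurve F) : W.toAffine.Point →+ (W.toAffine⁄(FunField W)).Point :=
  mapPoint W (algebraMap F (FunField W))

open Classical in
theorem map_constPoint {W : WeierstrassCurve F} (φ : FunField W →ₐ[F] FunField W) (Q : W.toAffine.Point) :
    Point.map φ (constPoint W Q) = constPoint W Q := by
  rcases Q with _ | ⟨c, d, h⟩
  · rfl
  · change Point.some _ _ _ = Point.some _ _ _
    congr 1 <;> exact φ.commutes _

section generic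
variable (W : WeierstrassCurve F) [W.IsElliptic]

theorem nonsingular_coord :
    (W.map (algebraMap F (FunField W))).toAffine.Nonsingular (coordX W) (coordY W) := by
  rw [← WeierstrassCurve.Affine.equation_iff_nonsingular, WeierstrassCurve.Affine.equation_iff]
  exact coord_equation W

/-- The generic point of the curve, with coordinates in the function field. -/
def genericPoint : (W.toAffine⁄(FunField W)).Point := .some _ _ (nonsingular_coord W)

variable {W}

-- Points whose coordinates are algebraic over `F` form a subgroup containing the constant points.
-- The generic point is outside it, so its constant translates are too; in particular they are not
-- zero.
open Classical in
theorem genericPoint_add_constPoint_notMem (Q : W.toAffine.Point) :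
    genericPoint W + constPoint W Q ∉
      (Point.map (W' := W.toAffine) (algebraicClosure F (FunField W)).val).range := by
  set A := (Point.map (W' := W.toAffine) (algebraicClosure F (FunField W)).val).range
  have hQ : constPoint W Q ∈ A := by
    rcases Q with _ | ⟨c, d, h⟩
    · exact A.zero_mem
    · exact ⟨.some (algebraMap F _ c) (algebraMap F _ d)
        ((W.toAffine.map_nonsingular (algebraMap F _).injective ..).mpr h), rfl⟩
  rw [A.add_mem_cancel_right hQ]
  rintro ⟨_ | ⟨x, y, h⟩, hxy⟩
  · cases hxy
  · have hxy' : Point.some _ _ _ = Point.some _ _ _ := hxy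
    injection hxy' with hx hy
    refine coordX_not_isIntegral W ?_
    rw [← hx]
    exact mem_algebraicClosure_iff.mp x.2 |>.isIntegral

open Classical in
theorem exists_algHom_genericPoint (Q : W.toAffine.Point) :
    ∃ φ : FunField W →ₐ[F] FunField W,
      Point.map φ (genericPoint W) = genericPoint W + constPoint W Q := by
  have hmem := genericPoint_add_constPoint_notMem Q
  rcases hg : genericPoint W + constPoint W Q with _ | ⟨x, y, h⟩
  · rw [hg] at hmem
    exact absurd (AddSubgroup.zero_mem _) hmem
  · rw [hg] at hmem
    have he := (WeierstrassCurve.Affine.equation_iff ..).mp h.1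
    -- If the first coordinate were algebraic, the equation would make the second algebraic too, and
    -- the point would lie in the excluded subgroup.
    have hx : ¬ IsIntegral F x := by
      intro hx
      have hy := isIntegral_of_equation he hx
      refine hmem ⟨.some ⟨x, mem_algebraicClosure_iff.mpr hx.isAlgebraic⟩
        ⟨y, mem_algebraicClosure_iff.mpr hy.isAlgebraic⟩ ?_, rfl⟩
      exact (W.toAffine.baseChange_nonsingular
        (f := (algebraicClosure F (FunField W)).val) (RingHom.injective _) ..).mp h
    obtain ⟨φ, hφx, hφy⟩ := exists_algHom he hx
    refine ⟨φ, ?_⟩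
    change Point.some _ _ _ = Point.some _ _ _
    congr 1

open Classical in
theorem algHom_eq_of_map_genericPoint_eq {φ ψ : FunField W →ₐ[F] FunField W}
    (h : Point.map φ (genericPoint W) = Point.map ψ (genericPoint W)) : φ = ψ := by
  have h' : Point.some _ _ _ = Point.some _ _ _ := h
  injection h' with hx hy
  have := funField_hom_ext (φ := (φ : FunField W →+* FunField W))
    (ψ := (ψ : FunField W →+* FunField W)) (fun c => by simp) hx hy
  exact AlgHom.ext fun z => DFunLike.congr_fun this z

open Classical in
/-- The pull-back of functions along the map `P ↦ P + Q` of the curve. -/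
def pullbackHom (Q : W.toAffine.Point) : FunField W →ₐ[F] FunField W :=
  (exists_algHom_genericPoint Q).choose

open Classical in
theorem map_pullbackHom (Q : W.toAffine.Point) :
    Point.map (pullbackHom Q) (genericPoint W) = genericPoint W + constPoint W Q :=
  (exists_algHom_genericPoint Q).choose_spec

-- Field endomorphisms over `F` act additively on points and fix constant ones, so η goes to η + Q
-- and then to η + P + Q; the image of η determines the endomorphism.
open Classical in
theorem pullbackHom_comp (P Q : W.toAffine.Point) :
    (pullbackHom P).comp (pullbackHom Q) = pullbackHom (P + Q) := by
  apply algHom_eq_of_map_genericPoint_eq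
  rw [← Point.map_map, map_pullbackHom, map_add, map_pullbackHom, map_constPoint, map_pullbackHom,
    map_add, add_assoc]

theorem pullbackHom_zero : pullbackHom (0 : W.toAffine.Point) = AlgHom.id F _ := by
  classical
  apply algHom_eq_of_map_genericPoint_eq
  rw [map_pullbackHom, map_zero, add_zero]
  rfl

open Classical in
/-- The automorphism of the function field which translates places by `Q`: the push-forward of
functions along `P ↦ P + Q`. -/
def translationEquiv (Q : W.toAffine.Point) : FunField W ≃ₐ[F] FunField W :=
  AlgEquiv.ofAlgHom (pullbackHom (-Q)) (pullbackHom Q)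
    (by rw [pullbackHom_comp, neg_add_cancel, pullbackHom_zero])
    (by rw [pullbackHom_comp, add_neg_cancel, pullbackHom_zero])

theorem translationEquiv_symm_apply (Q : W.toAffine.Point) (f : FunField W) :
    (translationEquiv Q).symm f = pullbackHom Q f := rfl

open Classical in
theorem translationEquiv_mul (P Q : W.toAffine.Point) :
    translationEquiv P * translationEquiv Q = translationEquiv (P + Q) := by
  refine AlgEquiv.ext fun f => ?_
  have h := DFunLike.congr_fun (pullbackHom_comp (-P) (-Q)) f
  rw [← neg_add] at h
  exact h

theorem translationEquiv_zero : translationEquiv (0 : W.toAffine.Point) = 1 := by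
  refine AlgEquiv.ext fun f => ?_
  have h := DFunLike.congr_fun (pullbackHom_zero (W := W)) f
  rw [← Point.neg_zero] at h
  exact h

theorem pullbackHom_coord {c d : F} (h : W.toAffine.Nonsingular c d) :
    pullbackHom (.some c d h) (coordX W) = (W.map (algebraMap F (FunField W))).toAffine.addX
        (coordX W) (algebraMap F _ c) (genericSlope W c d) ∧
      pullbackHom (.some c d h) (coordY W) = (W.map (algebraMap F (FunField W))).toAffine.addY
        (coordX W) (algebraMap F _ c) (coordY W) (genericSlope W c d) := by
  classical
  have hne : coordX W ≠ algebraMap F _ c := coordX_ne_algebraMap c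
  have h1 := map_pullbackHom (Point.some c d h)
  have hslope : (W.map (algebraMap F (FunField W))).toAffine.slope (coordX W) (algebraMap F _ c)
      (coordY W) (algebraMap F _ d) = genericSlope W c d :=
    WeierstrassCurve.Affine.slope_of_X_ne hne
  have h2 : genericPoint W + constPoint W (.some c d h) = _ := Point.add_some
    (W := (W.map (algebraMap F (FunField W))).toAffine) (h₁ := nonsingular_coord W)
    (h₂ := (W.toAffine.map_nonsingular (algebraMap F _).injective ..).mpr h) fun hh => hne hh.1
  rw [h2] at h1
  have h3 : Point.some _ _ _ = Point.some _ _ _ := h1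
  injection h3 with hx hy
  rw [hslope] at hx hy
  exact ⟨hx, hy⟩

end generic

end EllipticFunctionField
end

noncomputable section
namespace EllipticFunctionField

open WeierstrassCurve.Affine (Point)

variable {F : Type*} [Field F]

/-! ### The action of translations on places -/

section action
variable {W : WeierstrassCurve F} [W.IsElliptic]

-- When the x-coordinates differ, the slope through the generic point is regular at the place, and
-- taking residues in the addition formulas gives those of the sum.
open Classical in
theorem translationEquiv_smul_placeOf_of_X_ne {a b c d : F} (hp : W.toAffine.Nonsingular a b)
    (hQ : W.toAffine.Nonsingular c d) (hac : a ≠ c) :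
    translationEquiv (.some c d hQ) • placeOf W (.some a b hp) =
      placeOf W (.some a b hp + .some c d hQ) := by
  have hc := (placeOf W (.some a b hp)).hasResidue_algebraMap
  have hP := placeOf_some_hasCenter hp
  obtain ⟨hx, hy⟩ := pullbackHom_coord hQ
  rw [Point.add_of_X_ne hac]
  have hslope : W.toAffine.slope a c b d = (b - d) / (a - c) :=
    WeierstrassCurve.Affine.slope_of_X_ne hac
  have hs : (placeOf W (.some a b hp)).HasResidue (genericSlope W c d)
      (W.toAffine.slope a c b d) := by
    rw [hslope]
    exact (hP.coordY.sub (hc d)).div (hP.coordX.sub (hc c)) (sub_ne_zero.mpr hac)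
  set ℓ := W.toAffine.slope a c b d
  have hX : (placeOf W (.some a b hp)).HasResidue (pullbackHom (.some c d hQ) (coordX W))
      (W.toAffine.addX a c ℓ) := by
    rw [hx]
    exact ((((hs.pow 2).add ((hc W.a₁).mul hs)).sub (hc W.a₂)).sub hP.coordX).sub (hc c)
  have hY : (placeOf W (.some a b hp)).HasResidue (pullbackHom (.some c d hQ) (coordY W))
      (W.toAffine.addY a c b ℓ) := by
    rw [hy]
    rw [hx] at hX
    exact (((hs.mul (hX.sub hP.coordX)).add hP.coordY).neg.sub ((hc W.a₁).mul hX)).sub (hc W.a₃)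
  refine Place.HasCenter.eq_placeOf ⟨?_, ?_⟩ _
  · have := (Place.hasResidue_smul_iff (translationEquiv (.some c d hQ)) _ _ _).mpr hX
    rwa [← translationEquiv_symm_apply, AlgEquiv.apply_symm_apply] at this
  · have := (Place.hasResidue_smul_iff (translationEquiv (.some c d hQ)) _ _ _).mpr hY
    rwa [← translationEquiv_symm_apply, AlgEquiv.apply_symm_apply] at this

open Classical in
theorem translationEquiv_smul_placeOf [IsAlgClosed F] (Q p : W.toAffine.Point) :
    translationEquiv Q • placeOf W p = placeOf W (p + Q) := by
  rcases Q with _ | ⟨c, d, hQ⟩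
  · change translationEquiv (0 : W.toAffine.Point) • _ = placeOf W (p + 0)
    rw [translationEquiv_zero, one_smul, add_zero]
  set Q : W.toAffine.Point := .some c d hQ with hQdef
  choose φ hφ using exists_smul_placeOf_eq (translationEquiv Q)
  have hadd := add_eq_add_of_smul_placeOf_eq hφ
  -- The points not reached by the chord formula: the point at infinity and those sharing their
  -- x-coordinate with `Q`.
  let S : Set W.toAffine.Point := {0, Q, -Q}
  have hS (p : W.toAffine.Point) (hp : p ∉ S) : φ p = p + Q := by
    apply placeOf_injective
    rw [← hφ]
    rcases p with _ | ⟨a, b, hab⟩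
    · exact absurd (Or.inl rfl) hp
    · refine translationEquiv_smul_placeOf_of_X_ne hab hQ fun hac => hp (Or.inr ?_)
      exact Point.X_eq_iff.mp hac
  have hinf := infinite_point W
  -- There are infinitely many points, so some s has both s and s + p outside `S`. Affineness of φ
  -- at (s, p) gives φ p = p + φ 0; applying this to such an s identifies φ 0 with `Q`.
  have key (p : W.toAffine.Point) : ∃ s ∉ S, φ p = p + φ 0 := by
    have hfin : (S ∪ (· + p) ⁻¹' S).Finite :=
      (Set.toFinite S).union ((Set.toFinite S).preimage (add_left_injective p).injOn)
    obtain ⟨s, hs⟩ := hfin.exists_notMem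
    rw [Set.mem_union, not_or] at hs
    have h := hadd s p
    rw [hS s hs.1, hS (s + p) hs.2, add_right_comm s p Q, add_assoc (s + Q)] at h
    exact ⟨s, hs.1, add_left_cancel h⟩
  obtain ⟨s, hs, hp⟩ := key p
  obtain ⟨-, -, hs'⟩ := key s
  rw [hS s hs] at hs'
  rw [hφ, hp, ← add_left_cancel hs']

end action
/-! ### Constant field extension of translations and automorphisms -/

section geom
variable {W : WeierstrassCurve F}

open Classical in
/-- A rational point as a point over the algebraic closure. -/
def geomPoint (W : WeierstrassCurve F) : W.toAffine.Point →+ (geomCurve W).toAffine.Point :=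
  mapPoint W (algebraMap F (AlgebraicClosure F))

theorem restrict_placeOf_geomPoint (p : W.toAffine.Point) :
    (placeOf (geomCurve W) (geomPoint W p)).restrict = placeOf W p := by
  rcases p with _ | ⟨a, b, h⟩
  · exact (eq_infinitePlace_iff W _).mpr fun hm =>
      coordX_notMem_infinitePlace (geomCurve W) ((Place.coordX_mem_restrict_iff _).mp hm)
  · refine Place.HasCenter.eq_placeOf ((Place.hasCenter_restrict_iff _).mpr ?_) h
    exact placeOf_some_hasCenter
      ((W.toAffine.map_nonsingular (algebraMap F (AlgebraicClosure F)).injective ..).mpr h)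

theorem restrict_eq_of_forall {P : Place (AlgebraicClosure F) (FunField (geomCurve W))}
    {Q : Place F (FunField W)} (h : ∀ z, toGeom W z ∈ P.ring ↔ z ∈ Q.ring) : P.restrict = Q :=
  Place.ext (SetLike.ext fun z => by rw [Place.mem_restrict, h])

/-- A rational place has exactly one place above it: the centre, or the pole of x, is already
visible on the restriction. This makes the place `Q'` in `IsTranslation` unambiguous. -/
theorem eq_placeOf_geomPoint {P : Place (AlgebraicClosure F) (FunField (geomCurve W))}
    {p : W.toAffine.Point} (h : P.restrict = placeOf W p) :
    P = placeOf (geomCurve W) (geomPoint W p) := by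
  rcases p with _ | ⟨a, b, hab⟩
  · refine (eq_infinitePlace_iff _ P).mpr fun hm => ?_
    have := (Place.coordX_mem_restrict_iff P).mpr hm
    rw [h] at this
    exact coordX_notMem_infinitePlace W this
  · refine Place.HasCenter.eq_placeOf ((Place.hasCenter_restrict_iff P).mp ?_) _
    rw [h]
    exact placeOf_some_hasCenter hab

theorem restrict_smul {P : Place (AlgebraicClosure F) (FunField (geomCurve W))}
    {σ : FunField W ≃ₐ[F] FunField W}
    {σ' : FunField (geomCurve W) ≃ₐ[AlgebraicClosure F] FunField (geomCurve W)}
    (h : ∀ z, σ' (toGeom W z) = toGeom W (σ z)) : (σ' • P).restrict = σ • P.restrict := by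
  refine Place.ext (SetLike.ext fun z => ?_)
  rw [Place.mem_restrict, Place.mem_smul_iff, Place.mem_smul_iff, Place.mem_restrict]
  have := h (σ.symm z)
  rw [AlgEquiv.apply_symm_apply] at this
  rw [← this, AlgEquiv.symm_apply_apply]

theorem exists_geom_algHom (σ : FunField W ≃ₐ[F] FunField W) :
    ∃ φ : FunField (geomCurve W) →ₐ[AlgebraicClosure F] FunField (geomCurve W),
      ∀ z, φ (toGeom W z) = toGeom W (σ z) := by
  have he := congrArg (fun z => toGeom W (σ z)) (coord_equation W)
  simp only [map_add, map_mul, map_pow, AlgEquiv.commutes, toGeom_algebraMap] at he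
  -- An algebraic element over an algebraically closed field is a constant c; a polynomial over `F`
  -- killing c would also kill σ x, hence x.
  have hx : ¬ IsIntegral (AlgebraicClosure F) (toGeom W (σ (coordX W))) := by
    intro hx
    obtain ⟨c, hc⟩ := minpoly.mem_range_of_degree_eq_one _ _
      (IsAlgClosed.degree_eq_one_of_irreducible _ (minpoly.irreducible hx))
    obtain ⟨p, hp, hpc⟩ := Place.exists_aeval_eval_eq_zero c
    have h1 := toGeom_aeval W (σ (coordX W)) p
    rw [← hc, Polynomial.aeval_algebraMap_apply_eq_algebraMap_eval, hpc, map_zero,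
      map_eq_zero] at h1
    change Polynomial.aeval ((σ : FunField W →ₐ[F] FunField W) (coordX W)) p = 0 at h1
    rw [Polynomial.aeval_algHom_apply, map_eq_zero] at h1
    exact Place.aeval_coordX_ne_zero hp h1
  obtain ⟨φ, hφx, hφy⟩ := exists_algHom (W := geomCurve W) he hx
  refine ⟨φ, fun z => ?_⟩
  have key : RingHom.comp (φ : FunField (geomCurve W) →+* FunField (geomCurve W)) (toGeom W) =
      (toGeom W).comp (σ : FunField W →+* FunField W) := by
    refine funField_hom_ext (fun c => ?_) ?_ ?_
    · simp [toGeom_algebraMap]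
    · simpa [toGeom_coordX] using hφx
    · simpa [toGeom_coordY] using hφy
  exact DFunLike.congr_fun key z

/-- An automorphism of the function field extends to the constant field extension. -/
theorem exists_geom_algEquiv (σ : FunField W ≃ₐ[F] FunField W) :
    ∃ σ' : FunField (geomCurve W) ≃ₐ[AlgebraicClosure F] FunField (geomCurve W),
      ∀ z, σ' (toGeom W z) = toGeom W (σ z) := by
  have key (φ : FunField (geomCurve W) →ₐ[AlgebraicClosure F] FunField (geomCurve W))
      (h : ∀ z, φ (toGeom W z) = toGeom W z) : φ = AlgHom.id _ _ := by
    have hx := h (coordX W)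
    have hy := h (coordY W)
    rw [toGeom_coordX] at hx
    rw [toGeom_coordY] at hy
    have := funField_hom_ext (φ := (φ : FunField (geomCurve W) →+* FunField (geomCurve W)))
      (ψ := RingHom.id _) (fun c => by simp) hx hy
    exact AlgHom.ext fun z => DFunLike.congr_fun this z
  obtain ⟨φ, hφ⟩ := exists_geom_algHom σ
  obtain ⟨ψ, hψ⟩ := exists_geom_algHom σ.symm
  refine ⟨AlgEquiv.ofAlgHom φ ψ (key _ fun z => ?_) (key _ fun z => ?_), hφ⟩
  · rw [AlgHom.comp_apply, hψ, hφ, AlgEquiv.apply_symm_apply]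
  · rw [AlgHom.comp_apply, hφ, hψ, AlgEquiv.symm_apply_apply]

variable [W.IsElliptic]

instance : (geomCurve W).IsElliptic :=
  inferInstanceAs (W.map (algebraMap F (AlgebraicClosure F))).IsElliptic

theorem toGeom_pullbackHom (Q : W.toAffine.Point) (z : FunField W) :
    toGeom W (pullbackHom Q z) = pullbackHom (geomPoint W Q) (toGeom W z) := by
  rcases Q with _ | ⟨c, d, h⟩
  · change toGeom W (pullbackHom 0 z) = pullbackHom 0 (toGeom W z)
    rw [pullbackHom_zero, pullbackHom_zero]
    rfl
  · have hs : toGeom W (genericSlope W c d) = genericSlope (geomCurve W)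
        (algebraMap F (AlgebraicClosure F) c) (algebraMap F (AlgebraicClosure F) d) := by
      simp only [genericSlope, map_div₀, map_sub, toGeom_coordX, toGeom_coordY, toGeom_algebraMap]
    have h1 := pullbackHom_coord h
    have h2 := pullbackHom_coord
      ((W.toAffine.map_nonsingular (algebraMap F (AlgebraicClosure F)).injective ..).mpr h)
    have key : (toGeom W).comp (pullbackHom (.some c d h) : FunField W →+* FunField W) =
        RingHom.comp (pullbackHom (geomPoint W (.some c d h)) : FunField (geomCurve W) →+* _)
          (toGeom W) := by
      refine funField_hom_ext (fun e => ?_) ?_ ?_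
      · simp [toGeom_algebraMap]
      · simp only [RingHom.comp_apply, RingHom.coe_coe, toGeom_coordX]
        refine Eq.trans ?_ h2.1.symm
        rw [h1.1]
        simp [WeierstrassCurve.Affine.addX, hs, toGeom_coordX, toGeom_algebraMap]
      · simp only [RingHom.comp_apply, RingHom.coe_coe, toGeom_coordY]
        refine Eq.trans ?_ h2.2.symm
        rw [h1.2]
        simp [WeierstrassCurve.Affine.addX, WeierstrassCurve.Affine.addY,
          WeierstrassCurve.Affine.negAddY, WeierstrassCurve.Affine.negY, hs, toGeom_coordX,
          toGeom_coordY, toGeom_algebraMap]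
    exact DFunLike.congr_fun key z

open Classical in
theorem toGeom_translationEquiv (Q : W.toAffine.Point) (z : FunField W) :
    translationEquiv (geomPoint W Q) (toGeom W z) = toGeom W (translationEquiv Q z) := by
  have h := (toGeom_pullbackHom (-Q) z).symm
  rwa [map_neg] at h

open Classical in
theorem isTranslation_translationEquiv (Q : W.toAffine.Point) :
    IsTranslation W (placeOf W Q) (translationEquiv Q) := by
  refine ⟨translationEquiv (geomPoint W Q), toGeom_translationEquiv Q,
    placeOf (geomCurve W) (geomPoint W Q), fun z => ?_, fun P => ?_⟩
  · rw [← Place.mem_restrict, restrict_placeOf_geomPoint]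
  · obtain ⟨p, rfl⟩ := exists_eq_placeOf P.degree_eq_one_of_isAlgClosed
    rw [translationEquiv_smul_placeOf, isSum_placeOf_iff]

-- The relation with `Q'` forces the extension of σ to move every geometric place as the translation
-- does, so the two agree over the closure, and the inclusion of F(x, y) is injective.
open Classical in
theorem IsTranslation.eq {Q : W.toAffine.Point} {σ : FunField W ≃ₐ[F] FunField W}
    (h : IsTranslation W (placeOf W Q) σ) : σ = translationEquiv Q := by
  obtain ⟨σ', hσ, Q', hQ, h⟩ := h
  have hQ' : Q' = placeOf (geomCurve W) (geomPoint W Q) :=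
    eq_placeOf_geomPoint (restrict_eq_of_forall hQ)
  have key : (translationEquiv (geomPoint W Q))⁻¹ * σ' = 1 := by
    refine eq_one_of_forall_smul_eq fun P => ?_
    obtain ⟨p, rfl⟩ := exists_eq_placeOf P.degree_eq_one_of_isAlgClosed
    have hp := h (placeOf _ p)
    obtain ⟨q, hq⟩ := exists_smul_placeOf_eq σ' p
    rw [hq, hQ', isSum_placeOf_iff] at hp
    rw [mul_smul, inv_smul_eq_iff, hq, hp, translationEquiv_smul_placeOf]
  have hσ' := (inv_mul_eq_one.mp key).symm
  refine AlgEquiv.ext fun z => (toGeom W).injective ?_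
  rw [← hσ, hσ', toGeom_translationEquiv]

theorem isTranslation_placeOf_iff {Q : W.toAffine.Point} {σ : FunField W ≃ₐ[F] FunField W} :
    IsTranslation W (placeOf W Q) σ ↔ σ = translationEquiv Q :=
  ⟨IsTranslation.eq, by rintro rfl; exact isTranslation_translationEquiv Q⟩

theorem translation_placeOf (Q : W.toAffine.Point) :
    translation W (placeOf W Q) = translationEquiv Q := by
  have h : ∃ σ, IsTranslation W (placeOf W Q) σ := ⟨_, isTranslation_translationEquiv Q⟩
  rw [translation, dif_pos h]
  exact h.choose_spec.eq

open Classical in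
theorem translationEquiv_smul_infinitePlace (Q : W.toAffine.Point) :
    translationEquiv Q • infinitePlace W = placeOf W Q := by
  -- The image of O is computed over the algebraic closure, where the action is known at every
  -- point, and then restricted.
  have h := restrict_smul (P := placeOf (geomCurve W) 0) (toGeom_translationEquiv Q)
  rw [translationEquiv_smul_placeOf, zero_add, restrict_placeOf_geomPoint,
    ← map_zero (geomPoint W), restrict_placeOf_geomPoint] at h
  exact h.symm

open Classical in
/-- Conjugating a translation by an automorphism which fixes the infinite place. -/
theorem conj_translationEquiv {α : FunField W ≃ₐ[F] FunField W} (hα : α ∈ stabilizerO W)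
    {Q R : W.toAffine.Point} (hQR : α • placeOf W Q = placeOf W R) :
    α * translationEquiv Q * α⁻¹ = translationEquiv R := by
  obtain ⟨α', hα'⟩ := exists_geom_algEquiv α
  have hO : α' • infinitePlace (geomCurve W) = infinitePlace (geomCurve W) := by
    rw [eq_infinitePlace_iff, ← Place.coordX_mem_restrict_iff, restrict_smul hα',
      ← eq_infinitePlace_iff]
    rw [← placeOf_zero, ← map_zero (geomPoint W), restrict_placeOf_geomPoint]
    exact hα
  obtain ⟨σ', hσ', Q', hQ', hsum⟩ := isTranslation_translationEquiv Q
  -- Conjugating the witnesses shows that α τ_Q α⁻¹ satisfies the definition of translation by `R`;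
  -- since the extension of α also fixes the infinite place, the defining equivalence keeps its
  -- form.
  refine IsTranslation.eq ⟨α' * σ' * α'⁻¹, fun z => ?_, α' • Q', fun z => ?_, fun P => ?_⟩
  · have h := hα' (α⁻¹ z)
    rw [← AlgEquiv.mul_apply, mul_inv_cancel, AlgEquiv.one_apply] at h
    rw [← h, AlgEquiv.mul_apply, AlgEquiv.mul_apply, ← AlgEquiv.mul_apply α'⁻¹, inv_mul_cancel,
      AlgEquiv.one_apply, hσ', hα']
    rfl
  · rw [← Place.mem_restrict, restrict_smul hα', ← hQR,
      show Q'.restrict = placeOf W Q from restrict_eq_of_forall hQ']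
  · have h := (hsum (α'⁻¹ • P)).smul α'
    rw [smul_inv_smul, hO, ← mul_smul, ← mul_smul] at h
    exact h

end geom

/-! ### The automorphism group -/

section automorphisms
variable (W : WeierstrassCurve F) [W.IsElliptic]

/-- The subgroup of translations. -/
def translationSubgroup : Subgroup (FunField W ≃ₐ[F] FunField W) where
  carrier := Set.range (translationEquiv (W := W))
  one_mem' := ⟨0, translationEquiv_zero⟩
  mul_mem' := by
    classical
    rintro _ _ ⟨P, rfl⟩ ⟨Q, rfl⟩
    exact ⟨P + Q, (translationEquiv_mul P Q).symm⟩
  inv_mem' := by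
    classical
    rintro _ ⟨P, rfl⟩
    refine ⟨-P, eq_inv_of_mul_eq_one_left ?_⟩
    rw [translationEquiv_mul, neg_add_cancel, translationEquiv_zero]

variable {W}

/-- `Q` is the image of O under σ; since τ_Q also sends O to `Q`, the quotient fixes O. -/
theorem exists_translationEquiv_mul (σ : FunField W ≃ₐ[F] FunField W) :
    ∃ Q, ∃ α ∈ stabilizerO W, σ = translationEquiv Q * α := by
  obtain ⟨Q, hQ⟩ := exists_smul_placeOf_eq σ 0
  refine ⟨Q, (translationEquiv Q)⁻¹ * σ, ?_, (mul_inv_cancel_left _ _).symm⟩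
  rw [stabilizerO, MulAction.mem_stabilizer_iff, mul_smul, inv_smul_eq_iff,
    translationEquiv_smul_infinitePlace]
  exact hQ

theorem translationSubgroup_normal : (translationSubgroup W).Normal := by
  refine ⟨?_⟩
  rintro _ ⟨Q, rfl⟩ σ
  obtain ⟨P, α, hα, rfl⟩ := exists_translationEquiv_mul σ
  obtain ⟨R, hR⟩ := exists_smul_placeOf_eq α Q
  have h : translationEquiv P * α * translationEquiv Q * (translationEquiv P * α)⁻¹ =
      translationEquiv P * (α * translationEquiv Q * α⁻¹) * (translationEquiv P)⁻¹ := by group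
  rw [h, conj_translationEquiv hα hR]
  have hP : translationEquiv P ∈ translationSubgroup W := ⟨P, rfl⟩
  exact mul_mem (mul_mem hP ⟨R, rfl⟩) (inv_mem hP)

theorem translationSubgroup_isComplement' :
    (translationSubgroup W).IsComplement' (stabilizerO W) := by
  refine Subgroup.isComplement'_of_disjoint_and_mul_eq_univ ?_ ?_
  · rw [Subgroup.disjoint_def]
    rintro _ ⟨Q, rfl⟩ hQ
    rw [stabilizerO, MulAction.mem_stabilizer_iff, translationEquiv_smul_infinitePlace,
      ← placeOf_zero] at hQ
    rw [placeOf_injective hQ, translationEquiv_zero]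
  · refine Set.eq_univ_of_forall fun σ => ?_
    obtain ⟨P, α, hα, rfl⟩ := exists_translationEquiv_mul σ
    exact Set.mul_mem_mul ⟨P, rfl⟩ hα

end automorphisms

end EllipticFunctionField
end

theorem theorem3p1 {F : Type*} [Field F] [Finite F] (W : WeierstrassCurve F) [W.IsElliptic] :
    -- the objects in the statement are well defined: `O` is the unique common pole of `x` and `y`,
    (∀ P : Place F (FunField W),
      P = infinitePlace W ↔ coordX W ∉ P.ring ∧ coordY W ∉ P.ring) ∧
    -- `P ⊕ Q` is the unique rational place `R` with `P + Q ~ R + O`,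
    (∀ P Q : Place F (FunField W), P.degree = 1 → Q.degree = 1 →
      (placeAdd W P Q).degree = 1 ∧
      ∀ R : Place F (FunField W), R.degree = 1 → (placeAdd W P Q = R ↔ IsSum W P Q R)) ∧
    -- and `τ_Q` is the unique automorphism of `E / F` that is the translation by `Q`
    (∀ Q : Place F (FunField W), Q.degree = 1 → ∀ σ : FunField W ≃ₐ[F] FunField W,
      σ = translation W Q ↔ IsTranslation W Q σ) ∧
    -- the translations form a normal subgroup `T_E`, with complement `Aut(E, O)`
    (∃ T : Subgroup (FunField W ≃ₐ[F] FunField W),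
      (T : Set (FunField W ≃ₐ[F] FunField W)) =
        {σ | ∃ Q : Place F (FunField W), Q.degree = 1 ∧ σ = translation W Q} ∧
      T.Normal ∧ T.IsComplement' (stabilizerO W)) ∧
    -- the group law
    (∀ P Q : Place F (FunField W), P.degree = 1 → Q.degree = 1 →
      ∀ α ∈ stabilizerO W, ∀ β ∈ stabilizerO W,
        (α • Q).degree = 1 ∧
        (translation W P * α) * (translation W Q * β) =
          translation W (placeAdd W P (α • Q)) * (α * β)) := by
  refine ⟨fun P => ⟨?_, fun h => (eq_infinitePlace_iff W P).mpr h.1⟩, fun P Q hP hQ => ?_,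
    fun Q hQ σ => ?_, ⟨translationSubgroup W, ?_, translationSubgroup_normal,
      translationSubgroup_isComplement'⟩, fun P Q hP hQ α hα β _ => ?_⟩
  · rintro rfl
    exact (exists_commonPole W).choose_spec
  · classical
    obtain ⟨p, rfl⟩ := exists_eq_placeOf hP
    obtain ⟨q, rfl⟩ := exists_eq_placeOf hQ
    rw [placeAdd_placeOf]
    refine ⟨degree_placeOf _, fun R hR => ?_⟩
    obtain ⟨r, rfl⟩ := exists_eq_placeOf hR
    rw [isSum_placeOf_iff, placeOf_injective.eq_iff, eq_comm]
  · obtain ⟨q, rfl⟩ := exists_eq_placeOf hQ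
    rw [translation_placeOf, isTranslation_placeOf_iff]
  · ext σ
    constructor
    · rintro ⟨q, rfl⟩
      exact ⟨placeOf W q, degree_placeOf q, (translation_placeOf q).symm⟩
    · rintro ⟨Q, hQ, rfl⟩
      obtain ⟨q, rfl⟩ := exists_eq_placeOf hQ
      exact ⟨q, (translation_placeOf q).symm⟩
  · classical
    refine ⟨Place.degree_smul_eq_one α Q hQ, ?_⟩
    obtain ⟨p, rfl⟩ := exists_eq_placeOf hP
    obtain ⟨q, rfl⟩ := exists_eq_placeOf hQ
    obtain ⟨r, hr⟩ := exists_smul_placeOf_eq α q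
    -- Rewriting the translation by α(Q) as α τ_Q α⁻¹ leaves an identity valid in any group.
    rw [hr, placeAdd_placeOf, translation_placeOf, translation_placeOf, translation_placeOf,
      ← translationEquiv_mul, ← conj_translationEquiv hα hr]
    group
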